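/- Let $\mathcal M$ be a complete connected finite-dimensional smooth Riemannian manifold (without boundary) with Riemannian distance $d$ and Levi-Civita covariant derivative $\frac{D}{dt}$. A length-minimizing geodesic from $a$ to $b$ is a geodesic $\gamma:[0,1]\to\mathcal M$ with $\gamma(0)=a$, $\gamma(1)=b$ and length $d(a,b)$. For $a,b\in\mathcal M$ let $\log_a(b)\subset T_a\mathcal M$ be the set of initial velocities of the length-minimizing geodesics from $a$ to $b$, and for $w\in T_a\mathcal M$ let $\mathrm{pt}_b(w)\subset T_b\mathcal M$ be the set of all vectors obtained by parallel transport of $w$ along length-minimizing geodesics from $a$ to $b$. Put $$\mathrm D_{\mathrm{pt}}([x,y],[u,v])=\inf\{\,|z_1-z_2|_x \;:\; z_1\in\log_x(y),\ z_2\in\mathrm{pt}_x(w),\ w\in\log_u(v)\,\}.$$ For $\alpha_0,\alpha_1\in(0,\infty)$ and a finite sequence $u=(u_i)_{i=0}^n$ in $\mathcal M$ put $$\text{PT-TGV}^2_\alpha(u)=\inf_{y_0,\dots,y_{n-1}\in\mathcal M}\ \sum_{i=0}^{n-1}\alpha_1\, d(u_{i+1},y_i)+\sum_{i=1}^{n-1}\alpha_0\,\mathrm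 D_{\mathrm{pt}}([u_i,y_i],[u_{i-1},y_{i-1}]).$$ The sequence $u$ is called geodesic if there are $L\ge 0$ and a geodesic $\gamma:[0,L]\to\mathcal M$, of unit speed if $L>0$, with $\gamma(iL/n)=u_i$ for $0\le i\le n$ and $d(u_i,u_{i+1})=L/n$ for $0\le i\le n-1$ (for $L=0$ the interval is a point and $u$ is constant; a one-point sequence, $n=0$, is geodesic). It is called locally geodesic if $(u_{i-1},u_i,u_{i+1})$ is geodesic for every $i\in\{1,\dots,n-1\}$. Theorem. The following hold for all $n\ge 0$. (M-P1) If $\mathcal M=\mathbb R^K$ with the Euclidean metric, then $\text{PT-TGV}^2_\alpha$ is the univariate discrete vector-space TGV: $$\text{PT-TGV}^2_\alpha(u)=\inf_{w_0,\dots,w_{n-1}\in\mathbb R^K}\ \sum_{i=0}^{n-1}\alpha_1|(u_{i+1}-u_i)-w_i|+\sum_{i=1}^{n-1}\alpha_0|w_i-w_{i-1}|.$$ (M-P3) If the infimum defining $\text{PT-TGV}^2_\alpha(u)$ is attained at $y_i=u_{i+1}$, $0\le i\le n-1$, then $\text{PT-TGV}^2_\alpha(u)=\alpha_0\,\mathrm{TV}^2(u)$,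 where $\mathrm{TV}^2(u)=\sum_{i=1}^{n-1}\mathrm D_{\mathrm{pt}}([u_i,u_{i+1}],[u_{i-1},u_i])$, and this $\mathrm{TV}^2$ is an admissible generalization of the vector-space second-order total variation: for $\mathcal M=\mathbb R^K$ it equals $\sum_{i=1}^{n-1}|u_{i-1}-2u_i+u_{i+1}|$. If $u=(u_i)_{i=0}^n$ is locally geodesic, then $\text{PT-TGV}^2_\alpha(u)=0$. If $\text{PT-TGV}^2_\alpha(u)=0$ and for all $i,i'\in\{0,\dots,n\}$ with $|i-i'|\le 1$ there is exactly one length-minimizing geodesic $[0,1]\to\mathcal M$ from $u_i$ to $u_{i'}$, then $u$ is geodesic. -/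

import Mathlib

open Set Bundle
open scoped Manifold ContDiff ENNReal NNReal

/-!
Riemannian geometry in coordinates, on a boundaryless manifold `M` modelled on `E` whose tangent
bundle carries a Riemannian metric, and the parallel-transport version of second-order total
generalized variation for signals with values in `M`.
-/

noncomputable section

namespace PTTGV

section Geometry

variable {E : Type*} [NormedAddCommGroup E] [NormedSpace ℝ E]
  {M : Type*} [MetricSpace M] [ChartedSpace E M] [IsManifold 𝓘(ℝ, E) ∞ M]
  [RiemannianBundle (fun x : M ↦ TangentSpace 𝓘(ℝ, E) x)]

/-- The matrix `g_{ij}` of the Riemannian metric in the chart around `x₀`, as a bilinear form: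
`metricInChart x₀ p v w` is the inner product, at the point with coordinates `p`, of the tangent
vectors which have coordinates `v` and `w`. -/
def metricInChart (x₀ : M) (p v w : E) : ℝ :=
  inner ℝ
    ((trivializationAt E (TangentSpace 𝓘(ℝ, E) : M → Type _) x₀).symm ((chartAt E x₀).symm p) v)
    ((trivializationAt E (TangentSpace 𝓘(ℝ, E) : M → Type _) x₀).symm ((chartAt E x₀).symm p) w)

/-- The Christoffel symbols of the first kind of the Levi-Civita connection in the chart around
`x₀`, `Γ_{ij,k} = (∂_i g_{jk} + ∂_j g_{ik} - ∂_k g_{ij}) / 2`, as a trilinear form: the inner product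
of `∇_v w` with `z`, for the vector fields with constant coordinates `v`, `w`, `z`. -/
def christoffel (x₀ : M) (p v w z : E) : ℝ :=
  (fderiv ℝ (fun q ↦ metricInChart x₀ q w z) p v
    + fderiv ℝ (fun q ↦ metricInChart x₀ q v z) p w
    - fderiv ℝ (fun q ↦ metricInChart x₀ q v w) p z) / 2

/-- `V : s → TM` is a parallel vector field along its foot point curve `γ = π ∘ V`: it is
differentiable and its covariant derivative vanishes, `DV/dt = 0` on `s`. In each chart around a
point `γ t` the coordinates of `DV/dt` are `V̂ᵏ' + Γ^k_{ij} γ̂ⁱ' V̂ʲ`, and this vector is zero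
if and only if its inner product with every `z` is zero. -/
def IsParallelOn (V : ℝ → TangentBundle 𝓘(ℝ, E) M) (s : Set ℝ) : Prop :=
  MDifferentiableOn 𝓘(ℝ, ℝ) 𝓘(ℝ, E).tangent V s ∧
  ∀ t ∈ s, ∀ x₀ : M, (V t).proj ∈ (chartAt E x₀).source →
    let c : ℝ → E := fun τ ↦ chartAt E x₀ (V τ).proj
    let W : ℝ → E := fun τ ↦ (trivializationAt E (TangentSpace 𝓘(ℝ, E)) x₀ (V τ)).2
    ∀ z : E, metricInChart x₀ (c t) (derivWithin W s t) z
      + christoffel x₀ (c t) (derivWithin c s t) (W t) z = 0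

/-- The velocity `γ'(t)`, as an element of the tangent bundle, of a curve `γ` defined on `s`. -/
def velocity (γ : ℝ → M) (s : Set ℝ) (t : ℝ) : TangentBundle 𝓘(ℝ, E) M :=
  ⟨γ t, mfderivWithin 𝓘(ℝ, ℝ) 𝓘(ℝ, E) γ s t (1 : ℝ)⟩

/-- `γ : s → M` is a geodesic: it has zero acceleration, `D/dt (dγ/dt) = 0`. (Differentiability of
`γ` is part of the differentiability of `γ'` as a curve in the tangent bundle.) -/
def IsGeodesicOn (γ : ℝ → M) (s : Set ℝ) : Prop :=
  IsParallelOn (velocity (E := E) γ s) s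

/-- `γ : [0, 1] → M` is a length-minimizing geodesic from `a` to `b`. -/
def IsMinGeodesic (γ : ℝ → M) (a b : M) : Prop :=
  IsGeodesicOn (E := E) γ (Icc 0 1) ∧ γ 0 = a ∧ γ 1 = b ∧
    Manifold.pathELength 𝓘(ℝ, E) γ 0 1 = edist a b

/-- There is exactly one length-minimizing geodesic `[0, 1] → M` from `a` to `b`. -/
def HasUniqueMinGeodesic (a b : M) : Prop :=
  ∃ γ : ℝ → M, IsMinGeodesic (E := E) γ a b ∧
    ∀ γ' : ℝ → M, IsMinGeodesic (E := E) γ' a b → EqOn γ' γ (Icc 0 1)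

/-- The set-valued logarithm `log_a b`: the vectors `z ∈ T_a M` such that `exp_a z = b` and
`t ↦ exp_a (t z)`, `t ∈ [0, 1]`, is length-minimizing, that is, the initial velocities of the
length-minimizing geodesics from `a` to `b`. -/
def logSet (a b : M) : Set (TangentSpace 𝓘(ℝ, E) a) :=
  {z | ∃ γ : ℝ → M, IsMinGeodesic (E := E) γ a b ∧ velocity γ (Icc 0 1) 0 = ⟨a, z⟩}

/-- The set-valued parallel transport `pt_{a,b} v`: the results in `T_b M` of the parallel transport
of `v ∈ T_a M` along the length-minimizing geodesics from `a` to `b`. -/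
def ptSet (a b : M) (v : TangentSpace 𝓘(ℝ, E) a) : Set (TangentSpace 𝓘(ℝ, E) b) :=
  {z | ∃ (γ : ℝ → M) (V : ℝ → TangentBundle 𝓘(ℝ, E) M), IsMinGeodesic (E := E) γ a b ∧
    (∀ t ∈ Icc (0 : ℝ) 1, (V t).proj = γ t) ∧ IsParallelOn V (Icc 0 1) ∧
    V 0 = ⟨a, v⟩ ∧ V 1 = ⟨b, z⟩}

variable (E) in
/-- `D_pt([x, y], [u, v])`: the infimum of the Riemannian norm `|z₁ - z₂|_x` over all
`z₁ ∈ log_x y` and all `z₂ ∈ pt_x w` with `w ∈ log_u v`. -/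
def Dpt (x y u v : M) : ℝ≥0∞ :=
  ⨅ z₁ ∈ logSet (E := E) x y, ⨅ w ∈ logSet (E := E) u v, ⨅ z₂ ∈ ptSet u x w, ‖z₁ - z₂‖ₑ

/-! A signal `u₀, …, uₙ` is given by `n` and a sequence `u : ℕ → M`; only the values `u i` with
`i ≤ n` enter the definitions below. -/

variable (E) in
/-- The signal `u₀, …, uₙ` is geodesic: there is a geodesic `γ : [0, L] → M` with unit speed such
that `γ (i L / n) = u_i` for all `i` and `d(u_i, u_{i+1}) = L / n`. For `L = 0` the interval is a
point, the signal is constant and the condition on the speed is void. -/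
def IsGeodesicSeq (n : ℕ) (u : ℕ → M) : Prop :=
  ∃ (L : ℝ) (γ : ℝ → M), 0 ≤ L ∧ IsGeodesicOn (E := E) γ (Icc 0 L) ∧
    (0 < L → ∀ t ∈ Icc 0 L, ‖(velocity (E := E) γ (Icc 0 L) t).2‖ = 1) ∧
    (∀ i ≤ n, γ (i * L / n) = u i) ∧ ∀ i < n, dist (u i) (u (i + 1)) = L / n

variable (E) in
/-- The signal `u₀, …, uₙ` is locally geodesic: all three-point signals `u_i, u_{i+1}, u_{i+2}`
contained in it are geodesic. -/
def IsLocallyGeodesicSeq (n : ℕ) (u : ℕ → M) : Prop :=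
  ∀ i, i + 2 ≤ n → IsGeodesicSeq E 2 (fun j ↦ u (i + j))

variable (E) in
/-- The objective function in the definition of PT-TGV, for the signal `u₀, …, uₙ` and the end
points `y₀, …, y_{n-1}` of the tangent tuples `[u_i, y_i]`:
`∑_{i=0}^{n-1} α₁ d(u_{i+1}, y_i) + ∑_{i=1}^{n-1} α₀ D_pt([u_i, y_i], [u_{i-1}, y_{i-1}])`. -/
def ptCost (α₀ α₁ : ℝ≥0) (n : ℕ) (u y : ℕ → M) : ℝ≥0∞ :=
  (∑ i ∈ Finset.range n, α₁ * edist (u (i + 1)) (y i))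
    + ∑ i ∈ Finset.range (n - 1), α₀ * Dpt E (u (i + 1)) (y (i + 1)) (u i) (y i)

variable (E) in
/-- The functional PT-TGV of second order of the signal `u₀, …, uₙ`. -/
def ptTGV (α₀ α₁ : ℝ≥0) (n : ℕ) (u : ℕ → M) : ℝ≥0∞ :=
  ⨅ y : ℕ → M, ptCost E α₀ α₁ n u y

variable (E) in
/-- The functional `∑_{i=1}^{n-1} D_pt([u_i, u_{i+1}], [u_{i-1}, u_i])`. -/
def ptTV2 (n : ℕ) (u : ℕ → M) : ℝ≥0∞ :=
  ∑ i ∈ Finset.range (n - 1), Dpt E (u (i + 1)) (u (i + 2)) (u i) (u (i + 1))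

end Geometry

section VectorSpace

variable {F : Type*} [NormedAddCommGroup F]

/-- Univariate discrete TGV of second order of a vector-valued signal `u₀, …, uₙ`: the infimum over
`w₀, …, w_{n-1}` of
`∑_{i=0}^{n-1} α₁ |(u_{i+1} - u_i) - w_i| + ∑_{i=1}^{n-1} α₀ |w_i - w_{i-1}|`. -/
def vecTGV (α₀ α₁ : ℝ≥0) (n : ℕ) (u : ℕ → F) : ℝ :=
  ⨅ w : ℕ → F, ((∑ i ∈ Finset.range n, (α₁ : ℝ) * ‖(u (i + 1) - u i) - w i‖)
    + ∑ i ∈ Finset.range (n - 1), (α₀ : ℝ) * ‖w (i + 1) - w i‖)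

/-- Univariate discrete second-order TV of a vector-valued signal `u₀, …, uₙ`:
`∑_{i=1}^{n-1} |u_{i-1} - 2 u_i + u_{i+1}|`. -/
def vecTV2 (n : ℕ) (u : ℕ → F) : ℝ :=
  ∑ i ∈ Finset.range (n - 1), ‖u i - 2 • u (i + 1) + u (i + 2)‖

end VectorSpace

end PTTGV

end

noncomputable section

namespace PTTGV

open Filter Topology

set_option maxSynthPendingDepth 3

section Coordinates

variable {E : Type*} [NormedAddCommGroup E] [NormedSpace ℝ E]
  {M : Type*} [MetricSpace M] [ChartedSpace E M] [IsManifold 𝓘(ℝ, E) ∞ M]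
  [RiemannianBundle (fun x : M ↦ TangentSpace 𝓘(ℝ, E) x)]

/-- The coordinates of a tangent vector in the chart around `x₀`. -/
def tangentCoord (x₀ : M) (p : TangentBundle 𝓘(ℝ, E) M) : E :=
  (trivializationAt E (TangentSpace 𝓘(ℝ, E)) x₀ p).2

variable (E) in
/-- The Riemannian metric in the chart around `x₀`, as a continuous bilinear form. -/
def metricCLM (x₀ : M) (p : E) : E →L[ℝ] E →L[ℝ] ℝ :=
  (innerSL ℝ (E := TangentSpace 𝓘(ℝ, E) ((chartAt E x₀).symm p))).bilinearComp
    ((trivializationAt E (TangentSpace 𝓘(ℝ, E) : M → Type _) x₀).symmL ℝ ((chartAt E x₀).symm p))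
    ((trivializationAt E (TangentSpace 𝓘(ℝ, E) : M → Type _) x₀).symmL ℝ ((chartAt E x₀).symm p))

lemma metricCLM_apply {x₀ : M} {p : E} (hp : p ∈ (chartAt E x₀).target) (v w : E) :
    metricCLM E x₀ p v w = metricInChart x₀ p v w := by
  unfold metricCLM metricInChart
  rw [ContinuousLinearMap.bilinearComp_apply, innerSL_apply_apply]
  congr 1 <;> exact Trivialization.symmL_apply _ ((chartAt E x₀).map_target hp) _

lemma metricInChart_symm (x₀ : M) (p v w : E) :
    metricInChart x₀ p v w = metricInChart x₀ p w v := real_inner_comm _ _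

lemma christoffel_add_christoffel (x₀ : M) (p v w z : E) :
    christoffel x₀ p v w z + christoffel x₀ p v z w
      = fderiv ℝ (fun q ↦ metricInChart x₀ q w z) p v := by
  have h : ∀ a b : E, (fun q ↦ metricInChart x₀ q a b) = fun q ↦ metricInChart x₀ q b a :=
    fun a b ↦ funext fun q ↦ metricInChart_symm x₀ q a b
  unfold christoffel
  rw [h z w]
  ring

lemma metricInChart_tangentCoord {x₀ x : M} (hx : x ∈ (chartAt E x₀).source)
    (X Y : TangentSpace 𝓘(ℝ, E) x) :
    metricInChart x₀ (chartAt E x₀ x) (tangentCoord x₀ ⟨x, X⟩) (tangentCoord x₀ ⟨x, Y⟩)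
      = inner ℝ X Y := by
  let e := trivializationAt E (TangentSpace 𝓘(ℝ, E) : M → Type _) x₀
  have key : ∀ y, y = x →
      inner ℝ (e.symm y (tangentCoord x₀ ⟨x, X⟩)) (e.symm y (tangentCoord x₀ ⟨x, Y⟩))
        = inner ℝ X Y := by
    rintro y rfl
    have h := fun Z : TangentSpace 𝓘(ℝ, E) y ↦ e.symm_proj_apply ⟨y, Z⟩ hx
    simp only at h
    unfold tangentCoord
    rw [h, h]
  exact key _ ((chartAt E x₀).left_inv hx)

lemma metricInChart_tangentCoord_self {x₀ : M} {p : TangentBundle 𝓘(ℝ, E) M}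
    (hp : p.proj ∈ (chartAt E x₀).source) :
    metricInChart x₀ (chartAt E x₀ p.proj) (tangentCoord x₀ p) (tangentCoord x₀ p)
      = ‖p.2‖ ^ 2 :=
  (metricInChart_tangentCoord hp p.2 p.2).trans (real_inner_self_eq_norm_sq _)

lemma metricInChart_self_pos {x₀ : M} {p : E} (hp : p ∈ (chartAt E x₀).target) {v : E}
    (hv : v ≠ 0) : 0 < metricInChart x₀ p v v := by
  have hx := (chartAt E x₀).map_target hp
  let e := trivializationAt E (TangentSpace 𝓘(ℝ, E) : M → Type _) x₀
  refine real_inner_self_pos.2 fun h ↦ hv ?_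
  have h1 := e.apply_mk_symm hx v
  rw [h] at h1
  exact (congrArg Prod.snd h1).symm.trans (congrArg Prod.snd (e.zeroSection ℝ hx))

lemma metricCLM_isInvertible [FiniteDimensional ℝ E] {x₀ : M} {p : E} (hp : p ∈ (chartAt E x₀).target) :
    (metricCLM E x₀ p).IsInvertible := by
  have hinj : Function.Injective (metricCLM E x₀ p) := by
    refine (injective_iff_map_eq_zero _).2 fun v hv ↦ ?_
    by_contra h
    have := metricInChart_self_pos hp h
    rw [← metricCLM_apply hp, hv] at this
    simp at this
  have hfin : Module.finrank ℝ E = Module.finrank ℝ (E →L[ℝ] ℝ) := by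
    rw [← LinearMap.toContinuousLinearMap.finrank_eq, Module.finrank_linearMap_self]
  exact ⟨(LinearEquiv.ofInjectiveOfFinrankEq (metricCLM E x₀ p : E →ₗ[ℝ] E →L[ℝ] ℝ)
    hinj hfin).toContinuousLinearEquiv, by ext; rfl⟩

variable [IsContMDiffRiemannianBundle 𝓘(ℝ, E) ∞ E (fun x : M ↦ TangentSpace 𝓘(ℝ, E) x)]

lemma contDiffOn_metricInChart (x₀ : M) (v w : E) :
    ContDiffOn ℝ ∞ (fun p ↦ metricInChart x₀ p v w) (chartAt E x₀).target := by
  rw [← contMDiffOn_iff_contDiffOn]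
  let e := trivializationAt E (TangentSpace 𝓘(ℝ, E) : M → Type _) x₀
  have h : ∀ v : E, ContMDiffOn 𝓘(ℝ, E) 𝓘(ℝ, E).tangent ∞
      (fun p ↦ (⟨(chartAt E x₀).symm p, e.symm ((chartAt E x₀).symm p) v⟩ :
        TangentBundle 𝓘(ℝ, E) M)) (chartAt E x₀).target := by
    intro v
    refine (e.contMDiffOn_iff fun p hp ↦ ?_).2 ⟨contMDiffOn_chart_symm, ?_⟩
    · exact (chartAt E x₀).map_target hp
    · refine contMDiffOn_const (c := v) |>.congr fun p hp ↦ ?_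
      exact congrArg Prod.snd (e.apply_mk_symm ((chartAt E x₀).map_target hp) v)
  exact ContMDiffOn.inner_bundle (h v) (h w)

variable [FiniteDimensional ℝ E]

lemma contDiffOn_metricCLM (x₀ : M) :
    ContDiffOn ℝ ∞ (metricCLM E x₀) (chartAt E x₀).target := by
  refine contDiffOn_clm_apply.2 fun v ↦ contDiffOn_clm_apply.2 fun w ↦ ?_
  exact (contDiffOn_metricInChart x₀ v w).congr fun p hp ↦ metricCLM_apply hp v w

lemma hasFDerivAt_metricCLM {x₀ : M} {p : E} (hp : p ∈ (chartAt E x₀).target) :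
    HasFDerivAt (metricCLM E x₀) (fderiv ℝ (metricCLM E x₀) p) p :=
  (((contDiffOn_metricCLM x₀).contDiffAt
    ((chartAt E x₀).open_target.mem_nhds hp)).differentiableAt (by simp)).hasFDerivAt

lemma fderiv_metricInChart {x₀ : M} {p : E} (hp : p ∈ (chartAt E x₀).target) (v w z : E) :
    fderiv ℝ (fun q ↦ metricInChart x₀ q v w) p z = fderiv ℝ (metricCLM E x₀) p z v w := by
  have h := ((hasFDerivAt_metricCLM hp).clm_apply (hasFDerivAt_const v p)).clm_apply
    (hasFDerivAt_const w p)
  rw [(h.congr_of_eventuallyEq ?_).fderiv]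
  · simp
  · filter_upwards [(chartAt E x₀).open_target.mem_nhds hp] with q hq
    exact (metricCLM_apply hq v w).symm

variable (E) in
/-- The Christoffel symbols of the first kind, as a linear form in the last variable. -/
def christoffelCLM (x₀ : M) (p v w : E) : E →L[ℝ] ℝ :=
  (2⁻¹ : ℝ) • (fderiv ℝ (metricCLM E x₀) p v w + fderiv ℝ (metricCLM E x₀) p w v
    - ((fderiv ℝ (metricCLM E x₀) p).flip v).flip w)

lemma christoffelCLM_apply {x₀ : M} {p : E} (hp : p ∈ (chartAt E x₀).target) (v w z : E) :
    christoffelCLM E x₀ p v w z = christoffel x₀ p v w z := by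
  unfold christoffelCLM christoffel
  simp only [fderiv_metricInChart hp]
  simp
  ring

variable (E) in
/-- The coordinates `-Γ^k_{ij} vⁱ wʲ` of the derivative which makes a vector field parallel. -/
def transportField (x₀ : M) (p v w : E) : E :=
  -(metricCLM E x₀ p).inverse (christoffelCLM E x₀ p v w)

lemma eq_transportField_iff {x₀ : M} {p : E} (hp : p ∈ (chartAt E x₀).target) {v w a : E} :
    (∀ z, metricInChart x₀ p a z + christoffel x₀ p v w z = 0) ↔ a = transportField E x₀ p v w := by
  obtain ⟨e, he⟩ := metricCLM_isInvertible hp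
  have h1 : (∀ z, metricInChart x₀ p a z + christoffel x₀ p v w z = 0) ↔
      metricCLM E x₀ p a = -christoffelCLM E x₀ p v w := by
    rw [ContinuousLinearMap.ext_iff]
    refine forall_congr' fun z ↦ ?_
    rw [metricCLM_apply hp, _root_.neg_apply, christoffelCLM_apply hp,
      eq_neg_iff_add_eq_zero]
  rw [h1, transportField, ← he, ContinuousLinearMap.inverse_equiv, ← map_neg]
  exact e.eq_symm_apply.symm

lemma continuousOn_transportField (x₀ : M) :
    ContinuousOn (fun q : E × E × E ↦ transportField E x₀ q.1 q.2.1 q.2.2)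
      ((chartAt E x₀).target ×ˢ univ) := by
  have hD : ContinuousOn (fun q : E × E × E ↦ fderiv ℝ (metricCLM E x₀) q.1)
      ((chartAt E x₀).target ×ˢ univ) :=
    ((contDiffOn_metricCLM x₀).continuousOn_fderiv_of_isOpen (chartAt E x₀).open_target
      (by simp)).comp continuousOn_fst fun q hq ↦ hq.1
  have hG : ContinuousOn (fun q : E × E × E ↦ (metricCLM E x₀ q.1).inverse)
      ((chartAt E x₀).target ×ˢ univ) := by
    intro q hq
    have h := ((metricCLM_isInvertible hq.1).contDiffAt_map_inverse (n := 0)).continuousAt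
    exact ContinuousAt.comp_continuousWithinAt (f := fun q : E × E × E ↦ metricCLM E x₀ q.1) h
      (((contDiffOn_metricCLM x₀).continuousOn.comp continuousOn_fst fun q hq ↦ hq.1) q hq)
  have hflip : Continuous (fun D : E →L[ℝ] E →L[ℝ] E →L[ℝ] ℝ ↦ D.flip) :=
    (ContinuousLinearMap.flipₗᵢ ℝ E E (E →L[ℝ] ℝ)).continuous
  have hflip' : Continuous (fun D : E →L[ℝ] E →L[ℝ] ℝ ↦ D.flip) :=
    (ContinuousLinearMap.flipₗᵢ ℝ E E ℝ).continuous
  unfold transportField christoffelCLM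
  have h : ContinuousOn (fun q : E × E × E ↦ fderiv ℝ (metricCLM E x₀) q.1 q.2.1 q.2.2
      + fderiv ℝ (metricCLM E x₀) q.1 q.2.2 q.2.1
      - ((fderiv ℝ (metricCLM E x₀) q.1).flip q.2.1).flip q.2.2)
      ((chartAt E x₀).target ×ˢ univ) := by
    refine (((hD.clm_apply ?_).clm_apply ?_).add ((hD.clm_apply ?_).clm_apply ?_)).sub
      ((hflip'.comp_continuousOn ((hflip.comp_continuousOn hD).clm_apply ?_)).clm_apply ?_)
    all_goals fun_prop
  exact (hG.clm_apply (h.const_smul (2⁻¹ : ℝ))).neg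

end Coordinates

section Curves

variable {E : Type*} [NormedAddCommGroup E] [NormedSpace ℝ E]
  {M : Type*} [MetricSpace M] [ChartedSpace E M] [IsManifold 𝓘(ℝ, E) ∞ M]

lemma mdifferentiableWithinAt_iff_chart {γ : ℝ → M} {s : Set ℝ} {t : ℝ} {x₀ : M}
    (h : γ t ∈ (chartAt E x₀).source) :
    MDifferentiableWithinAt 𝓘(ℝ, ℝ) 𝓘(ℝ, E) γ s t ↔
      ContinuousWithinAt γ s t ∧ DifferentiableWithinAt ℝ (fun τ ↦ chartAt E x₀ (γ τ)) s t := by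
  rw [mdifferentiableWithinAt_iff_target_of_mem_source h,
    mdifferentiableWithinAt_iff_differentiableWithinAt]
  rfl

lemma mdifferentiableWithinAt_tangentBundle_iff {V : ℝ → TangentBundle 𝓘(ℝ, E) M} {s : Set ℝ}
    {t : ℝ} {x₀ : M} (h : (V t).proj ∈ (chartAt E x₀).source) :
    MDifferentiableWithinAt 𝓘(ℝ, ℝ) 𝓘(ℝ, E).tangent V s t ↔
      (ContinuousWithinAt (fun τ ↦ (V τ).proj) s t ∧
        DifferentiableWithinAt ℝ (fun τ ↦ chartAt E x₀ (V τ).proj) s t) ∧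
      DifferentiableWithinAt ℝ (fun τ ↦ tangentCoord x₀ (V τ)) s t := by
  rw [(trivializationAt E (TangentSpace 𝓘(ℝ, E)) x₀).mdifferentiableWithinAt_totalSpace_iff
    𝓘(ℝ, E) V h, mdifferentiableWithinAt_iff_chart (γ := fun τ ↦ (V τ).proj) h,
    mdifferentiableWithinAt_iff_differentiableWithinAt]
  rfl

lemma tangentCoord_velocity {γ : ℝ → M} {s : Set ℝ} {t : ℝ} {x₀ : M}
    (h : γ t ∈ (chartAt E x₀).source) (hs : UniqueDiffWithinAt ℝ s t)
    (hγ : MDifferentiableWithinAt 𝓘(ℝ, ℝ) 𝓘(ℝ, E) γ s t) :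
    tangentCoord x₀ (velocity (E := E) γ s t) = derivWithin (fun τ ↦ chartAt E x₀ (γ τ)) s t := by
  have h1 := (trivializationAt E (TangentSpace 𝓘(ℝ, E)) x₀).continuousLinearMapAt_apply_of_mem
    (R := ℝ) h (mfderivWithin 𝓘(ℝ, ℝ) 𝓘(ℝ, E) γ s t (1 : ℝ))
  rw [TangentBundle.continuousLinearMapAt_trivializationAt h] at h1
  refine h1.symm.trans ?_
  have h2 := mfderiv_comp_mfderivWithin t (mdifferentiableAt_extChartAt (I := 𝓘(ℝ, E)) h) hγ
    hs.uniqueMDiffWithinAt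
  rw [mfderivWithin_eq_fderivWithin] at h2
  exact (DFunLike.congr_fun h2 (1 : ℝ)).symm

lemma tangentCoord_injective {x₀ x : M} (h : x ∈ (chartAt E x₀).source)
    {v w : TangentSpace 𝓘(ℝ, E) x} (hvw : tangentCoord x₀ ⟨x, v⟩ = tangentCoord x₀ ⟨x, w⟩) :
    v = w := by
  let e := trivializationAt E (TangentSpace 𝓘(ℝ, E) : M → Type _) x₀
  have h1 := e.symm_proj_apply ⟨x, v⟩ h
  have h2 := e.symm_proj_apply ⟨x, w⟩ h
  have h3 : (e ⟨x, v⟩).2 = (e ⟨x, w⟩).2 := hvw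
  rw [h3] at h1
  exact h1.symm.trans h2

lemma tangentBundle_ext_of_tangentCoord {x₀ : M} {p q : TangentBundle 𝓘(ℝ, E) M}
    (h : p.proj ∈ (chartAt E x₀).source) (hpq : p.proj = q.proj)
    (hc : tangentCoord x₀ p = tangentCoord x₀ q) : p = q := by
  obtain ⟨x, v⟩ := p
  obtain ⟨y, w⟩ := q
  obtain rfl : x = y := hpq
  rw [tangentCoord_injective h hc]

omit [NormedSpace ℝ E] [IsManifold 𝓘(ℝ, E) ∞ M] in
lemma continuousWithinAt_eventually_mem_source {γ : ℝ → M} {s : Set ℝ} {t : ℝ} {x₀ : M}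
    (hγ : ContinuousWithinAt γ s t) (h : γ t ∈ (chartAt E x₀).source) :
    ∀ᶠ τ in 𝓝[s] t, γ τ ∈ (chartAt E x₀).source :=
  hγ ((chartAt E x₀).open_source.mem_nhds h)

variable [RiemannianBundle (fun x : M ↦ TangentSpace 𝓘(ℝ, E) x)]
  [IsContMDiffRiemannianBundle 𝓘(ℝ, E) ∞ E (fun x : M ↦ TangentSpace 𝓘(ℝ, E) x)]
  [FiniteDimensional ℝ E]

/-- Parallel fields in coordinates. -/
lemma isParallelOn_iff {V : ℝ → TangentBundle 𝓘(ℝ, E) M} {s : Set ℝ} :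
    IsParallelOn V s ↔ ∀ t ∈ s, ∀ x₀ : M, (V t).proj ∈ (chartAt E x₀).source →
      (ContinuousWithinAt (fun τ ↦ (V τ).proj) s t ∧
        DifferentiableWithinAt ℝ (fun τ ↦ chartAt E x₀ (V τ).proj) s t) ∧
      DifferentiableWithinAt ℝ (fun τ ↦ tangentCoord x₀ (V τ)) s t ∧
      derivWithin (fun τ ↦ tangentCoord x₀ (V τ)) s t
        = transportField E x₀ (chartAt E x₀ (V t).proj)
          (derivWithin (fun τ ↦ chartAt E x₀ (V τ).proj) s t) (tangentCoord x₀ (V t)) := by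
  constructor
  · rintro ⟨h1, h2⟩ t ht x₀ hx
    have h3 := (mdifferentiableWithinAt_tangentBundle_iff hx).1 (h1 t ht)
    exact ⟨h3.1, h3.2, (eq_transportField_iff ((chartAt E x₀).map_source hx)).1 (h2 t ht x₀ hx)⟩
  · intro h
    refine ⟨fun t ht ↦ ?_, fun t ht x₀ hx ↦ ?_⟩
    · have h3 := h t ht (V t).proj (mem_chart_source E _)
      exact (mdifferentiableWithinAt_tangentBundle_iff (mem_chart_source E _)).2 ⟨h3.1, h3.2.1⟩
    · exact (eq_transportField_iff ((chartAt E x₀).map_source hx)).2 (h t ht x₀ hx).2.2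

lemma IsGeodesicOn.mdifferentiableWithinAt {γ : ℝ → M} {s : Set ℝ}
    (h : IsGeodesicOn (E := E) γ s) {t : ℝ} (ht : t ∈ s) :
    MDifferentiableWithinAt 𝓘(ℝ, ℝ) 𝓘(ℝ, E) γ s t :=
  (mdifferentiableWithinAt_iff_chart (mem_chart_source E _)).2
    (isParallelOn_iff.1 h t ht (γ t) (mem_chart_source E _)).1

lemma IsGeodesicOn.continuousOn {γ : ℝ → M} {s : Set ℝ}
    (h : IsGeodesicOn (E := E) γ s) : ContinuousOn γ s := fun _ ht ↦
  (h.mdifferentiableWithinAt ht).continuousWithinAt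

lemma IsGeodesicOn.hasDerivWithinAt_chart {γ : ℝ → M} {s : Set ℝ} (hs : UniqueDiffOn ℝ s)
    (h : IsGeodesicOn (E := E) γ s) {t : ℝ} (ht : t ∈ s) {x₀ : M}
    (hx : γ t ∈ (chartAt E x₀).source) :
    HasDerivWithinAt (fun τ ↦ chartAt E x₀ (γ τ)) (tangentCoord x₀ (velocity γ s t)) s t := by
  rw [tangentCoord_velocity hx (hs t ht) (h.mdifferentiableWithinAt ht)]
  exact (isParallelOn_iff.1 h t ht x₀ hx).1.2.hasDerivWithinAt

lemma IsGeodesicOn.hasDerivWithinAt_tangentCoord {γ : ℝ → M} {s : Set ℝ} (hs : UniqueDiffOn ℝ s)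
    (h : IsGeodesicOn (E := E) γ s) {t : ℝ} (ht : t ∈ s) {x₀ : M}
    (hx : γ t ∈ (chartAt E x₀).source) :
    HasDerivWithinAt (fun τ ↦ tangentCoord x₀ (velocity γ s τ))
      (transportField E x₀ (chartAt E x₀ (γ t)) (tangentCoord x₀ (velocity γ s t))
        (tangentCoord x₀ (velocity γ s t))) s t := by
  obtain ⟨-, h2, h3⟩ := isParallelOn_iff.1 h t ht x₀ hx
  have h4 := (h.hasDerivWithinAt_chart hs ht hx).derivWithin (hs t ht)
  have h5 := h2.hasDerivWithinAt
  rw [h3] at h5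
  exact h4 ▸ h5

/-- Geodesics solve a second-order differential equation in coordinates. -/
lemma isGeodesicOn_iff {γ : ℝ → M} {s : Set ℝ} (hs : UniqueDiffOn ℝ s) :
    IsGeodesicOn (E := E) γ s ↔ ContinuousOn γ s ∧
      ∀ t ∈ s, ∀ x₀ : M, γ t ∈ (chartAt E x₀).source → ∃ W : ℝ → E,
        (∀ᶠ τ in 𝓝[s] t, HasDerivWithinAt (fun τ ↦ chartAt E x₀ (γ τ)) (W τ) s τ) ∧
        HasDerivWithinAt W (transportField E x₀ (chartAt E x₀ (γ t)) (W t) (W t)) s t := by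
  constructor
  · intro h
    refine ⟨h.continuousOn, fun t ht x₀ hx ↦ ⟨fun τ ↦ tangentCoord x₀ (velocity γ s τ), ?_, ?_⟩⟩
    · filter_upwards [self_mem_nhdsWithin,
        continuousWithinAt_eventually_mem_source (h.continuousOn t ht) hx] with τ hτ hτx
      exact h.hasDerivWithinAt_chart hs hτ hτx
    · exact h.hasDerivWithinAt_tangentCoord hs ht hx
  · rintro ⟨hc, h⟩
    have hd : ∀ τ ∈ s, MDifferentiableWithinAt 𝓘(ℝ, ℝ) 𝓘(ℝ, E) γ s τ := by
      intro τ hτ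
      obtain ⟨W, h1, -⟩ := h τ hτ (γ τ) (mem_chart_source E _)
      exact (mdifferentiableWithinAt_iff_chart (mem_chart_source E _)).2
        ⟨hc τ hτ, (h1.self_of_nhdsWithin hτ).differentiableWithinAt⟩
    refine isParallelOn_iff.2 fun t ht x₀ hx ↦ ?_
    replace hx : γ t ∈ (chartAt E x₀).source := hx
    obtain ⟨W, h1, h2⟩ := h t ht x₀ hx
    have hW : ∀ᶠ τ in 𝓝[s] t, tangentCoord x₀ (velocity γ s τ) = W τ := by
      filter_upwards [h1, self_mem_nhdsWithin,
        continuousWithinAt_eventually_mem_source (hc t ht) hx] with τ h3 hτ hτx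
      rw [tangentCoord_velocity hτx (hs τ hτ) (hd τ hτ), h3.derivWithin (hs τ hτ)]
    have h3 := h1.self_of_nhdsWithin ht
    have hWt := hW.self_of_nhdsWithin ht
    have h4 := h2.congr_of_eventuallyEq hW hWt
    refine ⟨⟨hc t ht, h3.differentiableWithinAt⟩, h4.differentiableWithinAt, ?_⟩
    rw [h4.derivWithin (hs t ht), hWt]
    congr 1
    exact (h3.derivWithin (hs t ht)).symm

lemma hasDerivWithinAt_metricInChart {x₀ : M} {c W₁ W₂ : ℝ → E} {s : Set ℝ} {t : ℝ} {v a₁ a₂ : E}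
    (hp : c t ∈ (chartAt E x₀).target) (hc : HasDerivWithinAt c v s t)
    (h₁ : HasDerivWithinAt W₁ a₁ s t) (h₂ : HasDerivWithinAt W₂ a₂ s t) :
    HasDerivWithinAt (fun τ ↦ metricInChart x₀ (c τ) (W₁ τ) (W₂ τ))
      (fderiv ℝ (fun q ↦ metricInChart x₀ q (W₁ t) (W₂ t)) (c t) v
        + metricInChart x₀ (c t) a₁ (W₂ t) + metricInChart x₀ (c t) (W₁ t) a₂) s t := by
  have hG : HasDerivWithinAt (fun τ ↦ metricCLM E x₀ (c τ)) (fderiv ℝ (metricCLM E x₀) (c t) v) s t :=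
    (hasFDerivAt_metricCLM hp).comp_hasDerivWithinAt t hc
  have h := (hG.clm_apply h₁).clm_apply h₂
  rw [fderiv_metricInChart hp, ← metricCLM_apply hp, ← metricCLM_apply hp]
  refine (h.congr_deriv rfl).congr_of_eventuallyEq ?_ (metricCLM_apply hp _ _).symm
  filter_upwards [hc.continuousWithinAt ((chartAt E x₀).open_target.mem_nhds hp)] with τ hτ
  exact (metricCLM_apply hτ _ _).symm

/-- The Levi-Civita connection is compatible with the metric. -/
lemma hasDerivWithinAt_inner_of_isParallelOn {γ : ℝ → M} {X Y : ∀ t, TangentSpace 𝓘(ℝ, E) (γ t)}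
    {s : Set ℝ} (hX : IsParallelOn (fun t ↦ (⟨γ t, X t⟩ : TangentBundle 𝓘(ℝ, E) M)) s)
    (hY : IsParallelOn (fun t ↦ (⟨γ t, Y t⟩ : TangentBundle 𝓘(ℝ, E) M)) s) {t : ℝ} (ht : t ∈ s) :
    HasDerivWithinAt (fun τ ↦ (inner ℝ (X τ) (Y τ) : ℝ)) 0 s t := by
  have hx := mem_chart_source E (γ t)
  obtain ⟨⟨hc, hd⟩, hX1, hX2⟩ := isParallelOn_iff.1 hX t ht (γ t) hx
  obtain ⟨-, hY1, hY2⟩ := isParallelOn_iff.1 hY t ht (γ t) hx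
  have hp := (chartAt E (γ t)).map_source hx
  have hX3 := (eq_transportField_iff hp).2 hX2
  have hY3 := (eq_transportField_iff hp).2 hY2
  have h := hasDerivWithinAt_metricInChart (x₀ := γ t) hp hd.hasDerivWithinAt
    hX1.hasDerivWithinAt hY1.hasDerivWithinAt
  refine (h.congr_deriv ?_).congr_of_eventuallyEq ?_ (metricInChart_tangentCoord hx _ _).symm
  · have h1 := hX3 (tangentCoord (γ t) ⟨γ t, Y t⟩)
    have h2 := hY3 (tangentCoord (γ t) ⟨γ t, X t⟩)
    have h3 := christoffel_add_christoffel (γ t) (chartAt E (γ t) (γ t))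
      (derivWithin (fun τ ↦ chartAt E (γ t) (γ τ)) s t)
      (tangentCoord (γ t) ⟨γ t, X t⟩) (tangentCoord (γ t) ⟨γ t, Y t⟩)
    rw [metricInChart_symm] at h2
    linarith
  · filter_upwards [hc ((chartAt E (γ t)).open_source.mem_nhds hx)] with τ hτ
    exact (metricInChart_tangentCoord hτ _ _).symm

lemma inner_eq_of_isParallelOn {γ : ℝ → M} {X Y : ∀ t, TangentSpace 𝓘(ℝ, E) (γ t)} {a b : ℝ}
    (hX : IsParallelOn (fun t ↦ (⟨γ t, X t⟩ : TangentBundle 𝓘(ℝ, E) M)) (Icc a b))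
    (hY : IsParallelOn (fun t ↦ (⟨γ t, Y t⟩ : TangentBundle 𝓘(ℝ, E) M)) (Icc a b)) {t : ℝ}
    (ht : t ∈ Icc a b) : (inner ℝ (X t) (Y t) : ℝ) = inner ℝ (X a) (Y a) := by
  refine constant_of_derivWithin_zero (f := fun τ ↦ (inner ℝ (X τ) (Y τ) : ℝ)) (fun τ hτ ↦
    (hasDerivWithinAt_inner_of_isParallelOn hX hY hτ).differentiableWithinAt) (fun τ hτ ↦ ?_) t ht
  exact (hasDerivWithinAt_inner_of_isParallelOn hX hY ⟨hτ.1, hτ.2.le⟩).derivWithin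
    (uniqueDiffOn_Icc (hτ.1.trans_lt hτ.2) τ ⟨hτ.1, hτ.2.le⟩)

lemma norm_sub_eq_of_isParallelOn {γ : ℝ → M} {X Y : ∀ t, TangentSpace 𝓘(ℝ, E) (γ t)} {a b : ℝ}
    (hX : IsParallelOn (fun t ↦ (⟨γ t, X t⟩ : TangentBundle 𝓘(ℝ, E) M)) (Icc a b))
    (hY : IsParallelOn (fun t ↦ (⟨γ t, Y t⟩ : TangentBundle 𝓘(ℝ, E) M)) (Icc a b)) {t : ℝ}
    (ht : t ∈ Icc a b) : ‖X t - Y t‖ = ‖X a - Y a‖ := by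
  rw [← sq_eq_sq₀ (norm_nonneg _) (norm_nonneg _), norm_sub_sq_real, norm_sub_sq_real,
    ← real_inner_self_eq_norm_sq, ← real_inner_self_eq_norm_sq, ← real_inner_self_eq_norm_sq,
    ← real_inner_self_eq_norm_sq, inner_eq_of_isParallelOn hX hX ht,
    inner_eq_of_isParallelOn hX hY ht, inner_eq_of_isParallelOn hY hY ht]

lemma IsGeodesicOn.norm_velocity_eq {γ : ℝ → M} {a b : ℝ}
    (h : IsGeodesicOn (E := E) γ (Icc a b)) {t : ℝ} (ht : t ∈ Icc a b) :
    ‖(velocity (E := E) γ (Icc a b) t).2‖ = ‖(velocity (E := E) γ (Icc a b) a).2‖ := by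
  have := inner_eq_of_isParallelOn h h ht
  rw [real_inner_self_eq_norm_sq, real_inner_self_eq_norm_sq,
    sq_eq_sq₀ (norm_nonneg _) (norm_nonneg _)] at this
  exact this

end Curves

section Geodesics

lemma hasDerivWithinAt_ite {F : Type*} [NormedAddCommGroup F] [NormedSpace ℝ F] {a b c t : ℝ}
    {f₁ f₂ : ℝ → F} {d : F} (hf : f₁ b = f₂ b)
    (h₁ : t ∈ Icc a b → HasDerivWithinAt f₁ d (Icc a b) t)
    (h₂ : t ∈ Icc b c → HasDerivWithinAt f₂ d (Icc b c) t) :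
    HasDerivWithinAt (fun τ ↦ if τ ≤ b then f₁ τ else f₂ τ) d (Icc a c) t := by
  have e₁ : EqOn (fun τ ↦ if τ ≤ b then f₁ τ else f₂ τ) f₁ (Icc a b) := fun τ hτ ↦ if_pos hτ.2
  have e₂ : EqOn (fun τ ↦ if τ ≤ b then f₁ τ else f₂ τ) f₂ (Icc b c) := by
    intro τ hτ
    rcases hτ.1.eq_or_lt with rfl | h
    · exact (if_pos le_rfl).trans hf
    · exact if_neg h.not_ge
  refine HasDerivWithinAt.mono (t := Icc a b ∪ Icc b c) (HasDerivWithinAt.union ?_ ?_)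
    Icc_subset_Icc_union_Icc
  · by_cases h : t ∈ Icc a b
    · exact (h₁ h).congr e₁ (e₁ h)
    · exact HasFDerivWithinAt.of_notMem_closure (by rwa [isClosed_Icc.closure_eq])
  · by_cases h : t ∈ Icc b c
    · exact (h₂ h).congr e₂ (e₂ h)
    · exact HasFDerivWithinAt.of_notMem_closure (by rwa [isClosed_Icc.closure_eq])

variable {E : Type*} [NormedAddCommGroup E] [NormedSpace ℝ E]
  {M : Type*} [MetricSpace M] [ChartedSpace E M] [IsManifold 𝓘(ℝ, E) ∞ M]

lemma tangentCoord_smul {x₀ x : M} (h : x ∈ (chartAt E x₀).source) (k : ℝ)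
    (v : TangentSpace 𝓘(ℝ, E) x) :
    tangentCoord x₀ (⟨x, k • v⟩ : TangentBundle 𝓘(ℝ, E) M) = k • tangentCoord x₀ ⟨x, v⟩ := by
  let e := trivializationAt E (TangentSpace 𝓘(ℝ, E) : M → Type _) x₀
  have h1 := e.continuousLinearMapAt_apply_of_mem (R := ℝ) h
  unfold tangentCoord
  rw [← h1, ← h1, map_smul]

lemma velocity_congr {γ γ' : ℝ → M} {s : Set ℝ} (hs : UniqueDiffOn ℝ s) (h : EqOn γ γ' s)
    {t : ℝ} (ht : t ∈ s) (hγ : MDifferentiableWithinAt 𝓘(ℝ, ℝ) 𝓘(ℝ, E) γ s t) :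
    velocity (E := E) γ s t = velocity γ' s t := by
  have hγ' : MDifferentiableWithinAt 𝓘(ℝ, ℝ) 𝓘(ℝ, E) γ' s t :=
    hγ.congr (fun τ hτ ↦ (h hτ).symm) (h ht).symm
  have hx := mem_chart_source E (γ t)
  refine tangentBundle_ext_of_tangentCoord hx (h ht) ?_
  rw [tangentCoord_velocity hx (hs t ht) hγ, tangentCoord_velocity (h ht ▸ hx) (hs t ht) hγ']
  exact derivWithin_congr (fun τ hτ ↦ congrArg _ (h hτ)) (congrArg _ (h ht))

lemma velocity_comp_affine {γ : ℝ → M} {s s' : Set ℝ} (hs : UniqueDiffOn ℝ s)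
    (hs' : UniqueDiffOn ℝ s') {k l : ℝ} (hm : MapsTo (fun τ ↦ k * τ + l) s' s) {t : ℝ}
    (ht : t ∈ s') (hγ : MDifferentiableWithinAt 𝓘(ℝ, ℝ) 𝓘(ℝ, E) γ s (k * t + l)) :
    velocity (E := E) (fun τ ↦ γ (k * τ + l)) s' t
      = ⟨γ (k * t + l), k • (velocity (E := E) γ s (k * t + l)).2⟩ := by
  have hx := mem_chart_source E (γ (k * t + l))
  have hd := ((mdifferentiableWithinAt_iff_chart hx).1 hγ).2.hasDerivWithinAt
  have ha : HasDerivWithinAt (fun τ ↦ k * τ + l) k s' t := by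
    simpa using ((hasDerivWithinAt_id t s').const_mul k).add_const l
  have hc := hd.scomp t ha hm
  have hγ' : MDifferentiableWithinAt 𝓘(ℝ, ℝ) 𝓘(ℝ, E) (fun τ ↦ γ (k * τ + l)) s' t :=
    (mdifferentiableWithinAt_iff_chart (γ := fun τ ↦ γ (k * τ + l)) hx).2
      ⟨hγ.continuousWithinAt.comp (f := fun τ ↦ k * τ + l) ha.continuousWithinAt hm,
        hc.differentiableWithinAt⟩
  refine tangentBundle_ext_of_tangentCoord (x₀ := γ (k * t + l)) hx rfl ?_
  rw [tangentCoord_velocity (γ := fun τ ↦ γ (k * τ + l)) hx (hs' t ht) hγ']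
  refine (hc.derivWithin (hs' t ht)).trans (Eq.trans ?_ (tangentCoord_smul hx _ _).symm)
  rw [← tangentCoord_velocity hx (hs _ (hm ht)) hγ]
  rfl

variable [RiemannianBundle (fun x : M ↦ TangentSpace 𝓘(ℝ, E) x)]

lemma transportField_smul (x₀ : M) (p v w : E) (k : ℝ) :
    transportField E x₀ p (k • v) (k • w) = (k * k) • transportField E x₀ p v w := by
  have h : christoffelCLM E x₀ p (k • v) (k • w) = (k * k) • christoffelCLM E x₀ p v w := by
    ext z
    simp [christoffelCLM]
    ring
  rw [transportField, h, map_smul, transportField, smul_neg]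

variable [IsContMDiffRiemannianBundle 𝓘(ℝ, E) ∞ E (fun x : M ↦ TangentSpace 𝓘(ℝ, E) x)]
  [FiniteDimensional ℝ E]

lemma isGeodesicOn_const (x : M) (s : Set ℝ) : IsGeodesicOn (E := E) (fun _ ↦ x) s := by
  have hV : velocity (E := E) (fun _ ↦ x) s = fun _ ↦ ⟨x, 0⟩ := by
    funext t
    unfold velocity
    rw [mfderivWithin_const]
    rfl
  unfold IsGeodesicOn
  rw [hV]
  refine isParallelOn_iff.2 fun t ht x₀ hx ↦ ⟨⟨continuousWithinAt_const,
    differentiableWithinAt_const _⟩, differentiableWithinAt_const _, ?_⟩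
  have h := tangentCoord_smul hx 0 0
  simp only [zero_smul] at h
  have h' := transportField_smul x₀ (chartAt E x₀ x) 0 0 0
  simp only [zero_smul, mul_zero] at h'
  simp [h, h']

lemma IsGeodesicOn.comp_affine {γ : ℝ → M} {s s' : Set ℝ} (h : IsGeodesicOn (E := E) γ s)
    (hs : UniqueDiffOn ℝ s) (hs' : UniqueDiffOn ℝ s') {k l : ℝ}
    (hm : MapsTo (fun τ ↦ k * τ + l) s' s) :
    IsGeodesicOn (E := E) (fun τ ↦ γ (k * τ + l)) s' := by
  have ha : ∀ t, HasDerivWithinAt (fun τ ↦ k * τ + l) k s' t := fun t ↦ by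
    simpa using ((hasDerivWithinAt_id t s').const_mul k).add_const l
  have hac : ContinuousOn (fun τ ↦ k * τ + l) s' := fun t _ ↦ (ha t).continuousWithinAt
  rw [isGeodesicOn_iff hs] at h
  refine (isGeodesicOn_iff hs').2 ⟨h.1.comp hac hm, fun t ht x₀ hx ↦ ?_⟩
  obtain ⟨W, h1, h2⟩ := h.2 _ (hm ht) x₀ hx
  have htend : Tendsto (fun τ ↦ k * τ + l) (𝓝[s'] t) (𝓝[s] (k * t + l)) :=
    (ha t).continuousWithinAt.tendsto_nhdsWithin hm
  refine ⟨fun τ ↦ k • W (k * τ + l), ?_, ?_⟩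
  · filter_upwards [htend.eventually h1] with τ hτ
    exact hτ.scomp τ (ha τ) hm
  · refine ((h2.scomp t (ha t) hm).const_smul k).congr_deriv ?_
    rw [transportField_smul, mul_smul]

lemma IsGeodesicOn.mono {γ : ℝ → M} {s s' : Set ℝ} (h : IsGeodesicOn (E := E) γ s)
    (hs : UniqueDiffOn ℝ s) (hs' : UniqueDiffOn ℝ s') (hss : s' ⊆ s) :
    IsGeodesicOn (E := E) γ s' := by
  simpa using h.comp_affine hs hs' (k := 1) (l := 0) (fun τ hτ ↦ by simpa using hss hτ)

lemma IsGeodesicOn.velocity_mono {γ : ℝ → M} {s s' : Set ℝ} (h : IsGeodesicOn (E := E) γ s)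
    (hs : UniqueDiffOn ℝ s) (hs' : UniqueDiffOn ℝ s') (hss : s' ⊆ s) {t : ℝ} (ht : t ∈ s') :
    velocity (E := E) γ s' t = velocity γ s t := by
  have hx := mem_chart_source E (γ t)
  refine tangentBundle_ext_of_tangentCoord (x₀ := γ t) hx rfl ?_
  rw [tangentCoord_velocity hx (hs' t ht) ((h.mono hs hs' hss).mdifferentiableWithinAt ht)]
  exact ((h.hasDerivWithinAt_chart hs (hss ht) hx).mono hss).derivWithin (hs' t ht)

/-- Two geodesics with matching velocities at the junction form one geodesic. -/
lemma IsGeodesicOn.ite {γ₁ γ₂ : ℝ → M} {a b c : ℝ} (hab : a < b) (hbc : b < c)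
    (h₁ : IsGeodesicOn (E := E) γ₁ (Icc a b)) (h₂ : IsGeodesicOn (E := E) γ₂ (Icc b c))
    (h : velocity (E := E) γ₁ (Icc a b) b = velocity γ₂ (Icc b c) b) :
    IsGeodesicOn (E := E) (fun τ ↦ if τ ≤ b then γ₁ τ else γ₂ τ) (Icc a c) := by
  have u₁ := uniqueDiffOn_Icc hab
  have u₂ := uniqueDiffOn_Icc hbc
  have hb : γ₁ b = γ₂ b := congrArg TotalSpace.proj h
  set γ : ℝ → M := fun τ ↦ if τ ≤ b then γ₁ τ else γ₂ τ with hγ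
  have e₁ : ∀ τ ∈ Icc a b, γ τ = γ₁ τ := fun τ hτ ↦ if_pos hτ.2
  have e₂ : ∀ τ ∈ Icc b c, γ τ = γ₂ τ := by
    intro τ hτ
    rcases hτ.1.eq_or_lt with rfl | h
    · exact (if_pos le_rfl).trans hb
    · exact if_neg h.not_ge
  have hcont : ContinuousOn γ (Icc a c) := by
    have := (h₁.continuousOn.congr e₁).union_of_isClosed (h₂.continuousOn.congr e₂)
      isClosed_Icc isClosed_Icc
    rwa [Icc_union_Icc_eq_Icc hab.le hbc.le] at this
  refine (isGeodesicOn_iff (uniqueDiffOn_Icc (hab.trans hbc))).2 ⟨hcont, fun t ht x₀ hx ↦ ?_⟩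
  let W : ℝ → E := fun τ ↦ if τ ≤ b then tangentCoord x₀ (velocity γ₁ (Icc a b) τ)
    else tangentCoord x₀ (velocity γ₂ (Icc b c) τ)
  have f₁ : ∀ τ ∈ Icc a b, W τ = tangentCoord x₀ (velocity γ₁ (Icc a b) τ) :=
    fun τ hτ ↦ if_pos hτ.2
  have f₂ : ∀ τ ∈ Icc b c, W τ = tangentCoord x₀ (velocity γ₂ (Icc b c) τ) := by
    intro τ hτ
    rcases hτ.1.eq_or_lt with rfl | h'
    · exact (if_pos le_rfl).trans (congrArg _ h)
    · exact if_neg h'.not_ge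
  have hchart : (fun τ ↦ chartAt E x₀ (γ τ))
      = fun τ ↦ if τ ≤ b then chartAt E x₀ (γ₁ τ) else chartAt E x₀ (γ₂ τ) := by
    funext τ
    exact apply_ite _ _ _ _
  refine ⟨W, ?_, ?_⟩
  · filter_upwards [self_mem_nhdsWithin,
      continuousWithinAt_eventually_mem_source (hcont t ht) hx] with τ hτ hτx
    rw [hchart]
    refine hasDerivWithinAt_ite (congrArg _ hb) (fun hτ' ↦ ?_) (fun hτ' ↦ ?_)
    · rw [f₁ τ hτ']
      exact h₁.hasDerivWithinAt_chart u₁ hτ' (e₁ τ hτ' ▸ hτx)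
    · rw [f₂ τ hτ']
      exact h₂.hasDerivWithinAt_chart u₂ hτ' (e₂ τ hτ' ▸ hτx)
  · refine hasDerivWithinAt_ite (congrArg _ h) (fun ht' ↦ ?_) (fun ht' ↦ ?_)
    · rw [f₁ t ht', e₁ t ht']
      exact h₁.hasDerivWithinAt_tangentCoord u₁ ht' (e₁ t ht' ▸ hx)
    · rw [f₂ t ht', e₂ t ht']
      exact h₂.hasDerivWithinAt_tangentCoord u₂ ht' (e₂ t ht' ▸ hx)

lemma IsGeodesicOn.contMDiffOn {γ : ℝ → M} {s : Set ℝ} (h : IsGeodesicOn (E := E) γ s)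
    (hs : UniqueDiffOn ℝ s) : ContMDiffOn 𝓘(ℝ, ℝ) 𝓘(ℝ, E) 1 γ s := by
  intro t ht
  have hx := mem_chart_source E (γ t)
  have hev := continuousWithinAt_eventually_mem_source (h.continuousOn t ht) hx
  rw [contMDiffWithinAt_iff_target_of_mem_source hx, contMDiffWithinAt_iff_contDiffWithinAt]
  refine ⟨h.continuousOn t ht, ?_⟩
  have hcd : ContDiffWithinAt ℝ (0 + 1) (fun τ ↦ chartAt E (γ t) (γ τ)) s t := by
    rw [contDiffWithinAt_succ_iff_hasFDerivWithinAt' (by simp), insert_eq_of_mem ht]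
    refine ⟨{τ | τ ∈ s ∧ γ τ ∈ (chartAt E (γ t)).source},
      Filter.inter_mem self_mem_nhdsWithin hev, fun τ hτ ↦ hτ.1, by simp,
      fun τ ↦ ContinuousLinearMap.toSpanSingleton ℝ (tangentCoord (γ t) (velocity γ s τ)),
      fun τ hτ ↦ (h.hasDerivWithinAt_chart hs hτ.1 hτ.2).hasFDerivWithinAt, ?_⟩
    refine contDiffWithinAt_zero ht |>.2 ⟨_, Filter.inter_mem self_mem_nhdsWithin hev, ?_⟩
    have hc : ContinuousOn (fun τ ↦ tangentCoord (γ t) (velocity γ s τ))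
        (s ∩ ({τ | τ ∈ s} ∩ {τ | γ τ ∈ (chartAt E (γ t)).source})) := fun τ hτ ↦
      (h.hasDerivWithinAt_tangentCoord hs hτ.1 hτ.2.2).continuousWithinAt.mono inter_subset_left
    exact (ContinuousLinearMap.toSpanSingletonCLE (𝕜 := ℝ) (E := E)).continuous.comp_continuousOn hc
  exact (zero_add (1 : WithTop ℕ∞)) ▸ hcd

lemma IsGeodesicOn.pathELength_eq {γ : ℝ → M} {a b : ℝ}
    (h : IsGeodesicOn (E := E) γ (Icc a b)) (hab : a ≤ b) :
    Manifold.pathELength 𝓘(ℝ, E) γ a b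
      = ENNReal.ofReal ((b - a) * ‖(velocity (E := E) γ (Icc a b) a).2‖) := by
  rw [Manifold.pathELength_eq_lintegral_mfderivWithin_Icc,
    MeasureTheory.setLIntegral_congr_fun (g := fun _ ↦ ‖(velocity (E := E) γ (Icc a b) a).2‖ₑ)
      measurableSet_Icc]
  · rw [MeasureTheory.setLIntegral_const, Real.volume_Icc, ENNReal.ofReal_mul (by linarith),
      ofReal_norm, mul_comm]
  · intro t ht
    have := h.norm_velocity_eq ht
    simp only [← ofReal_norm]
    exact congrArg ENNReal.ofReal this

lemma isMinGeodesic_iff {γ : ℝ → M} {x y : M} :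
    IsMinGeodesic (E := E) γ x y ↔ IsGeodesicOn (E := E) γ (Icc 0 1) ∧ γ 0 = x ∧ γ 1 = y ∧
      ‖(velocity (E := E) γ (Icc 0 1) 0).2‖ = dist x y := by
  unfold IsMinGeodesic
  refine and_congr_right fun h ↦ and_congr_right fun _ ↦ and_congr_right fun _ ↦ ?_
  rw [h.pathELength_eq zero_le_one, edist_dist,
    ENNReal.ofReal_eq_ofReal_iff (by simp) dist_nonneg]
  simp

/-- Geodesics are Lipschitz continuous. -/
lemma IsGeodesicOn.dist_le [IsRiemannianManifold 𝓘(ℝ, E) M] {γ : ℝ → M} {a b : ℝ}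
    (h : IsGeodesicOn (E := E) γ (Icc a b)) {s t : ℝ} (hs : s ∈ Icc a b) (ht : t ∈ Icc a b) :
    dist (γ s) (γ t) ≤ |s - t| * ‖(velocity (E := E) γ (Icc a b) a).2‖ := by
  wlog hst : s < t generalizing s t
  · rcases (not_lt.1 hst).eq_or_lt with rfl | hlt
    · simp
    · rw [dist_comm, abs_sub_comm]
      exact this ht hs hlt
  have u := uniqueDiffOn_Icc (hs.1.trans_lt (hst.trans_le ht.2))
  have u' := uniqueDiffOn_Icc hst
  have hsub : Icc s t ⊆ Icc a b := Icc_subset_Icc hs.1 ht.2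
  have h' := h.mono u u' hsub
  have h1 := Manifold.riemannianEDist_le_pathELength (h'.contMDiffOn u') rfl rfl hst.le
  rw [← IsRiemannianManifold.out, h'.pathELength_eq hst.le, edist_dist,
    h.velocity_mono u u' hsub ⟨le_rfl, hst.le⟩,
    ENNReal.ofReal_le_ofReal_iff (mul_nonneg (by linarith) (norm_nonneg _))] at h1
  rwa [abs_sub_comm, abs_of_pos (sub_pos.2 hst), ← h.norm_velocity_eq hs]

end Geodesics

section Limits

/-- Pointwise limits of solutions of an autonomous differential equation which stay in a compact
set are solutions. -/
lemma exists_hasDerivWithinAt_of_ultrafilter {ι X : Type*} [NormedAddCommGroup X] [NormedSpace ℝ X]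
    (U : Ultrafilter ι) {I : Set ℝ} (hI : Convex ℝ I) {K : Set X} (hK : IsCompact K) {f : X → X}
    (hf : ContinuousOn f K) {z : ι → ℝ → X}
    (hz : ∀ᶠ k in U, ∀ τ ∈ I, z k τ ∈ K ∧ HasDerivWithinAt (z k) (f (z k τ)) I τ) :
    ∃ w : ℝ → X, ∀ τ ∈ I, Tendsto (fun k ↦ z k τ) U (𝓝 (w τ)) ∧
      HasDerivWithinAt w (f (w τ)) I τ := by
  have hlim : ∀ τ, ∃ x, τ ∈ I → x ∈ K ∧ Tendsto (fun k ↦ z k τ) U (𝓝 x) := by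
    intro τ
    by_cases hτ : τ ∈ I
    · obtain ⟨x, hx, hx'⟩ := hK.ultrafilter_le_nhds (U.map fun k ↦ z k τ)
        (le_principal_iff.2 (hz.mono fun k hk ↦ (hk τ hτ).1))
      exact ⟨x, fun _ ↦ ⟨hx, hx'⟩⟩
    · exact ⟨0, fun h ↦ absurd h hτ⟩
  choose w hw using hlim
  refine ⟨w, fun τ hτ ↦ ⟨(hw τ hτ).2, ?_⟩⟩
  obtain ⟨L, hL⟩ := hK.exists_bound_of_continuousOn hf
  have hfc : Tendsto (fun k ↦ f (z k τ)) U (𝓝 (f (w τ))) :=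
    (hf (w τ) (hw τ hτ).1).tendsto.comp
      (tendsto_nhdsWithin_iff.2 ⟨(hw τ hτ).2, hz.mono fun k hk ↦ (hk τ hτ).1⟩)
  rw [hasDerivWithinAt_iff_isLittleO, Asymptotics.isLittleO_iff]
  intro ε hε
  obtain ⟨δ, hδ, hδf⟩ := Metric.uniformContinuousOn_iff.1
    (hK.uniformContinuousOn_of_continuous hf) ε hε
  have hball : Metric.ball τ (δ / (|L| + 1)) ∈ 𝓝[I] τ :=
    nhdsWithin_le_nhds (Metric.ball_mem_nhds τ (by positivity))
  filter_upwards [self_mem_nhdsWithin, hball] with σ hσ hστ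
  have hseg : uIcc τ σ ⊆ I := segment_eq_uIcc τ σ ▸ hI.segment_subset hτ hσ
  have hest : ∀ᶠ k in U, ‖z k σ - z k τ - (σ - τ) • f (z k τ)‖ ≤ ε * ‖σ - τ‖ := by
    filter_upwards [hz] with k hk
    have hd : ∀ s ∈ uIcc τ σ, HasDerivWithinAt (z k) (f (z k s)) (uIcc τ σ) s :=
      fun s hs ↦ (hk s (hseg hs)).2.mono hseg
    have hlip : ∀ s ∈ uIcc τ σ, dist (z k s) (z k τ) < δ := by
      intro s hs
      rw [dist_eq_norm]
      refine ((convex_uIcc τ σ).norm_image_sub_le_of_norm_hasDerivWithin_le hd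
        (fun r hr ↦ hL _ (hk r (hseg hr)).1) left_mem_uIcc hs).trans_lt ?_
      have h1 : ‖s - τ‖ ≤ dist σ τ := by
        rw [Real.norm_eq_abs, Real.dist_eq]
        exact abs_sub_left_of_mem_uIcc hs
      rw [Metric.mem_ball, lt_div_iff₀ (by positivity)] at hστ
      nlinarith [le_abs_self L, norm_nonneg (s - τ), dist_nonneg (x := σ) (y := τ), abs_nonneg L]
    have hg : ∀ s ∈ uIcc τ σ, HasDerivWithinAt (fun r ↦ z k r - (r - τ) • f (z k τ))
        (f (z k s) - f (z k τ)) (uIcc τ σ) s := fun s hs ↦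
      ((hd s hs).sub (((hasDerivWithinAt_id s _).sub_const τ).smul_const (f (z k τ)))).congr_deriv
        (by rw [one_smul])
    have := (convex_uIcc τ σ).norm_image_sub_le_of_norm_hasDerivWithin_le hg (C := ε)
      (fun s hs ↦ by
        rw [← dist_eq_norm]
        exact (hδf _ (hk s (hseg hs)).1 _ (hk τ hτ).1 (hlip s hs)).le) left_mem_uIcc right_mem_uIcc
    simpa [sub_right_comm] using this
  exact le_of_tendsto ((((hw σ hσ).2.sub (hw τ hτ).2).sub (hfc.const_smul (σ - τ))).norm) hest

/-- Equi-Lipschitz curves in a complete locally compact space which start at the same point converge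
pointwise along an ultrafilter. -/
lemma exists_tendsto_of_dist_le {ι M : Type*} [MetricSpace M] [CompleteSpace M]
    [LocallyCompactSpace M] (U : Ultrafilter ι) {γ : ι → ℝ → M} {a : M} {C : ℝ}
    (h0 : ∀ k, γ k 0 = a)
    (hC : ∀ᶠ k in U, ∀ s ∈ Icc (0 : ℝ) 1, ∀ t ∈ Icc (0 : ℝ) 1, dist (γ k s) (γ k t) ≤ |s - t| * C)
    {t : ℝ} (ht : t ∈ Icc (0 : ℝ) 1) : ∃ p, Tendsto (fun k ↦ γ k t) U (𝓝 p) := by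
  let S : Set ℝ := {t | ∃ p, Tendsto (fun k ↦ γ k t) U (𝓝 p)}
  have hC0 : ∀ᶠ k in U, ∀ s ∈ Icc (0 : ℝ) 1, ∀ t ∈ Icc (0 : ℝ) 1,
      dist (γ k s) (γ k t) ≤ |s - t| * (|C| + 1) := hC.mono fun k hk s hs t ht ↦
    (hk s hs t ht).trans (mul_le_mul_of_nonneg_left (by linarith [le_abs_self C]) (abs_nonneg _))
  have hpos : 0 < |C| + 1 := by positivity
  suffices h : Icc 0 1 ⊆ S from h ht
  refine IsClosed.Icc_subset_of_forall_exists_gt ?_ ⟨a, by simp [h0]⟩ ?_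
  · refine isClosed_of_closure_subset fun t ht ↦ ?_
    have htI : t ∈ Icc (0 : ℝ) 1 := isClosed_Icc.closure_subset_iff.2 inter_subset_right ht
    refine ⟨?_, htI⟩
    have hcauchy : Cauchy (U.map fun k ↦ γ k t : Filter M) := by
      refine Metric.cauchy_iff.2 ⟨inferInstance, fun ε hε ↦ ?_⟩
      obtain ⟨s, ⟨⟨p, hp⟩, hs⟩, hst⟩ := Metric.mem_closure_iff.1 ht (ε / 4 / (|C| + 1))
        (by positivity)
      refine ⟨Metric.ball p (ε / 2), ?_, fun x hx y hy ↦ ?_⟩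
      · change ∀ᶠ k in U, γ k t ∈ Metric.ball p (ε / 2)
        filter_upwards [hC0, hp (Metric.ball_mem_nhds p (by positivity : 0 < ε / 4))] with k hk hk'
        have h1 := hk t htI s hs
        have h2 : dist (γ k s) p < ε / 4 := hk'
        rw [Real.dist_eq, lt_div_iff₀ hpos] at hst
        rw [Metric.mem_ball]
        linarith [dist_triangle (γ k t) (γ k s) p]
      · rw [Metric.mem_ball] at hx hy
        linarith [dist_triangle_right x y p]
    exact CompleteSpace.complete hcauchy
  · rintro t ⟨⟨p, hp⟩, ht⟩ t' ht'
    obtain ⟨r, hr, hrc⟩ := Metric.exists_isCompact_closedBall p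
    let s : ℝ := min (min 1 t') (t + r / 2 / (|C| + 1))
    have hts : t < s := lt_min (lt_min ht.2 ht') (by linarith [show 0 < r / 2 / (|C| + 1) by positivity])
    have hs1 : s ≤ 1 := (min_le_left _ _).trans (min_le_left _ _)
    refine ⟨s, ?_, hts, (min_le_left _ _).trans (min_le_right _ _)⟩
    have hmem : ∀ᶠ k in U, γ k s ∈ Metric.closedBall p r := by
      filter_upwards [hC0, hp (Metric.ball_mem_nhds p (by positivity : 0 < r / 2))] with k hk hk'
      have h1 := hk s ⟨ht.1.trans hts.le, hs1⟩ t ⟨ht.1, ht.2.le⟩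
      have h2 : dist (γ k t) p < r / 2 := hk'
      have h3 : s - t ≤ r / 2 / (|C| + 1) := by linarith [min_le_right (min 1 t') (t + r / 2 / (|C| + 1))]
      rw [le_div_iff₀ hpos] at h3
      rw [abs_of_pos (sub_pos.2 hts)] at h1
      rw [Metric.mem_closedBall]
      linarith [dist_triangle (γ k s) (γ k t) p]
    obtain ⟨q, -, hq⟩ := hrc.ultrafilter_le_nhds (U.map fun k ↦ γ k s) (le_principal_iff.2 hmem)
    exact ⟨q, hq⟩

variable {E : Type*} [NormedAddCommGroup E] [NormedSpace ℝ E]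
  {M : Type*} [MetricSpace M] [ChartedSpace E M] [IsManifold 𝓘(ℝ, E) ∞ M]
  [RiemannianBundle (fun x : M ↦ TangentSpace 𝓘(ℝ, E) x)]
  [IsContMDiffRiemannianBundle 𝓘(ℝ, E) ∞ E (fun x : M ↦ TangentSpace 𝓘(ℝ, E) x)]
  [FiniteDimensional ℝ E]

/-- On compact subsets of a chart the Riemannian norm dominates the norm of the model space. -/
lemma exists_mul_sq_norm_le_metricInChart {x₀ : M} {B : Set E} (hB : IsCompact B)
    (hBt : B ⊆ (chartAt E x₀).target) :
    ∃ m > 0, ∀ q ∈ B, ∀ v, m * ‖v‖ ^ 2 ≤ metricInChart x₀ q v v := by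
  have hc : ContinuousOn (fun q : E × E ↦ metricCLM E x₀ q.1 q.2 q.2)
      (B ×ˢ Metric.sphere (0 : E) 1) := by
    have h1 : ContinuousOn (fun q : E × E ↦ metricCLM E x₀ q.1) (B ×ˢ Metric.sphere (0 : E) 1) :=
      (contDiffOn_metricCLM x₀).continuousOn.comp continuousOn_fst fun q hq ↦ hBt hq.1
    exact (h1.clm_apply continuousOn_snd).clm_apply continuousOn_snd
  obtain ⟨m, hm, hmin⟩ := (hB.prod (isCompact_sphere (0 : E) 1)).exists_forall_le' hc (a := 0)
    fun q hq ↦ by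
      rw [metricCLM_apply (hBt hq.1)]
      exact metricInChart_self_pos (hBt hq.1) (Metric.ne_of_mem_sphere hq.2 one_ne_zero)
  refine ⟨m, hm, fun q hq v ↦ ?_⟩
  rw [← metricCLM_apply (hBt hq)]
  rcases eq_or_ne v 0 with rfl | hv
  · simp
  have hn : 0 < ‖v‖ := norm_pos_iff.2 hv
  have := hmin (q, ‖v‖⁻¹ • v) ⟨hq, by simp [norm_smul, hn.ne']⟩
  simp only [map_smul, _root_.smul_apply, smul_eq_mul] at this
  calc m * ‖v‖ ^ 2 ≤ ‖v‖⁻¹ * (‖v‖⁻¹ * metricCLM E x₀ q v v) * ‖v‖ ^ 2 := by gcongr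
    _ = metricCLM E x₀ q v v := by field_simp

variable [CompleteSpace M] [IsRiemannianManifold 𝓘(ℝ, E) M]

/-- Limits of minimizing geodesics are minimizing geodesics, and their velocities converge. -/
theorem exists_isMinGeodesic_of_tendsto {ι : Type*} (U : Ultrafilter ι) {γ : ι → ℝ → M} {a b : M}
    {y : ι → M} (hγ : ∀ k, IsMinGeodesic (E := E) (γ k) a (y k)) (hy : Tendsto y U (𝓝 b)) :
    ∃ η : ℝ → M, IsMinGeodesic (E := E) η a b ∧
      Tendsto (fun k ↦ tangentCoord a (velocity (E := E) (γ k) (Icc 0 1) 0)) U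
        (𝓝 (tangentCoord a (velocity (E := E) η (Icc 0 1) 0))) := by
  have : LocallyCompactSpace M := ChartedSpace.locallyCompactSpace E M
  have u01 : UniqueDiffOn ℝ (Icc (0 : ℝ) 1) := uniqueDiffOn_Icc zero_lt_one
  simp only [isMinGeodesic_iff] at hγ ⊢
  have hd : Tendsto (fun k ↦ dist a (y k)) U (𝓝 (dist a b)) := tendsto_const_nhds.dist hy
  set C : ℝ := dist a b + 1 with hCdef
  have hCpos : 0 < C := by positivity
  have hvC : ∀ᶠ k in U, dist a (y k) ≤ C :=
    (hd.eventually (gt_mem_nhds (by linarith : dist a b < C))).mono fun k hk ↦ le_of_lt hk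
  have hlip : ∀ᶠ k in U, ∀ s ∈ Icc (0 : ℝ) 1, ∀ t ∈ Icc (0 : ℝ) 1,
      dist (γ k s) (γ k t) ≤ |s - t| * C := by
    filter_upwards [hvC] with k hk s hs t ht
    refine ((hγ k).1.dist_le hs ht).trans ?_
    rw [(hγ k).2.2.2]
    exact mul_le_mul_of_nonneg_left hk (abs_nonneg _)
  have hlim : ∀ t, ∃ p, t ∈ Icc (0 : ℝ) 1 → Tendsto (fun k ↦ γ k t) U (𝓝 p) := by
    intro t
    by_cases ht : t ∈ Icc (0 : ℝ) 1
    · obtain ⟨p, hp⟩ := exists_tendsto_of_dist_le U (fun k ↦ (hγ k).2.1) hlip ht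
      exact ⟨p, fun _ ↦ hp⟩
    · exact ⟨a, fun h ↦ absurd h ht⟩
  choose η hη using hlim
  have hη0 : η 0 = a :=
    tendsto_nhds_unique (hη 0 (by simp)) (by simp [(hγ _).2.1])
  have hη1 : η 1 = b :=
    tendsto_nhds_unique (hη 1 (by simp)) (by simpa [(hγ _).2.2.1] using hy)
  have hηlip : ∀ s ∈ Icc (0 : ℝ) 1, ∀ t ∈ Icc (0 : ℝ) 1, dist (η s) (η t) ≤ |s - t| * C :=
    fun s hs t ht ↦ le_of_tendsto ((hη s hs).dist (hη t ht)) (hlip.mono fun k hk ↦ hk s hs t ht)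
  have hηc : ContinuousOn η (Icc 0 1) := by
    refine (LipschitzOnWith.of_dist_le_mul (K := C.toNNReal) fun s hs t ht ↦ ?_).continuousOn
    rw [Real.coe_toNNReal _ hCpos.le, mul_comm, Real.dist_eq]
    exact hηlip s hs t ht
  have key : ∀ t ∈ Icc (0 : ℝ) 1, ∀ x₀ : M, η t ∈ (chartAt E x₀).source → ∃ W : ℝ → E,
      (∀ᶠ τ in 𝓝[Icc 0 1] t, HasDerivWithinAt (fun τ ↦ chartAt E x₀ (η τ)) (W τ) (Icc 0 1) τ) ∧
      HasDerivWithinAt W (transportField E x₀ (chartAt E x₀ (η t)) (W t) (W t)) (Icc 0 1) t ∧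
      Tendsto (fun k ↦ tangentCoord x₀ (velocity (E := E) (γ k) (Icc 0 1) t)) U (𝓝 (W t)) := by
    intro t ht x₀ hx
    have hp := (chartAt E x₀).map_source hx
    obtain ⟨r, hr, hrt⟩ := Metric.nhds_basis_closedBall.mem_iff.1
      ((chartAt E x₀).open_target.mem_nhds hp)
    set B : Set E := Metric.closedBall (chartAt E x₀ (η t)) r
    have hBc : IsCompact B := isCompact_closedBall _ _
    obtain ⟨m, hm, hmB⟩ := exists_mul_sq_norm_le_metricInChart hBc hrt
    obtain ⟨ρ, hρ, hρs⟩ := Metric.nhds_basis_ball.mem_iff.1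
      (Filter.inter_mem ((chartAt E x₀).open_source.mem_nhds hx)
        (((chartAt E x₀).continuousAt hx) (Metric.closedBall_mem_nhds _ hr)))
    set I : Set ℝ := Icc 0 1 ∩ Metric.ball t (ρ / 2 / C) with hIdef
    have hIC : Convex ℝ I := (convex_Icc 0 1).inter (convex_ball _ _)
    have hIn : ∀ τ ∈ I, I ∈ 𝓝[Icc 0 1] τ := fun τ hτ ↦
      Filter.inter_mem self_mem_nhdsWithin (nhdsWithin_le_nhds (Metric.isOpen_ball.mem_nhds hτ.2))
    have htI : t ∈ I := ⟨ht, Metric.mem_ball_self (by positivity)⟩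
    have hnear : ∀ τ ∈ I, |τ - t| * C < ρ / 2 := fun τ hτ ↦ by
      have := hτ.2
      rwa [Metric.mem_ball, Real.dist_eq, lt_div_iff₀ hCpos] at this
    set R : ℝ := Real.sqrt (C ^ 2 / m) with hR
    have hz : ∀ᶠ k in U, ∀ τ ∈ I,
        (chartAt E x₀ (γ k τ), tangentCoord x₀ (velocity (E := E) (γ k) (Icc 0 1) τ))
          ∈ B ×ˢ Metric.closedBall (0 : E) R ∧
        HasDerivWithinAt (fun τ ↦ (chartAt E x₀ (γ k τ),
            tangentCoord x₀ (velocity (E := E) (γ k) (Icc 0 1) τ)))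
          (tangentCoord x₀ (velocity (E := E) (γ k) (Icc 0 1) τ),
            transportField E x₀ (chartAt E x₀ (γ k τ))
              (tangentCoord x₀ (velocity (E := E) (γ k) (Icc 0 1) τ))
              (tangentCoord x₀ (velocity (E := E) (γ k) (Icc 0 1) τ))) I τ := by
      filter_upwards [hlip, hvC, (hη t ht) (Metric.ball_mem_nhds _ (half_pos hρ))]
        with k hk hkC hkt τ hτ
      have hkt' : dist (γ k t) (η t) < ρ / 2 := hkt
      have hmem := hρs (show γ k τ ∈ Metric.ball (η t) ρ by
        rw [Metric.mem_ball]
        linarith [dist_triangle (γ k τ) (γ k t) (η t), hk τ hτ.1 t ht, hnear τ hτ])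
      have hsrc : γ k τ ∈ (chartAt E x₀).source := hmem.1
      have hB' : chartAt E x₀ (γ k τ) ∈ B := hmem.2
      refine ⟨⟨hB', ?_⟩, ?_⟩
      · have h1 := hmB _ hB' (tangentCoord x₀ (velocity (E := E) (γ k) (Icc 0 1) τ))
        have h2 := metricInChart_tangentCoord_self (p := velocity (E := E) (γ k) (Icc 0 1) τ) hsrc
        rw [(hγ k).1.norm_velocity_eq hτ.1, (hγ k).2.2.2] at h2
        have h3 : m * ‖tangentCoord x₀ (velocity (E := E) (γ k) (Icc 0 1) τ)‖ ^ 2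
          ≤ dist a (y k) ^ 2 := h1.trans_eq h2
        rw [mem_closedBall_zero_iff, hR]
        refine Real.le_sqrt_of_sq_le ?_
        rw [le_div_iff₀ hm, mul_comm]
        exact h3.trans (pow_le_pow_left₀ dist_nonneg hkC 2)
      · exact (((hγ k).1.hasDerivWithinAt_chart u01 hτ.1 hsrc).mono inter_subset_left).prodMk
          (((hγ k).1.hasDerivWithinAt_tangentCoord u01 hτ.1 hsrc).mono inter_subset_left)
    have hf : ContinuousOn (fun q : E × E ↦ (q.2, transportField E x₀ q.1 q.2 q.2))
        (B ×ˢ Metric.closedBall (0 : E) R) := by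
      refine continuousOn_snd.prodMk ?_
      exact (continuousOn_transportField x₀).comp (f := fun q : E × E ↦ (q.1, q.2, q.2))
        (by fun_prop) fun q hq ↦ ⟨hrt hq.1, mem_univ _⟩
    obtain ⟨w, hw⟩ := exists_hasDerivWithinAt_of_ultrafilter U hIC
      (hBc.prod (isCompact_closedBall (0 : E) R)) hf hz
    have hw1 : ∀ τ ∈ I, (w τ).1 = chartAt E x₀ (η τ) := by
      intro τ hτ
      have hsrc := (hρs (show η τ ∈ Metric.ball (η t) ρ by
        rw [Metric.mem_ball]
        linarith [hηlip τ hτ.1 t ht, hnear τ hτ])).1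
      exact tendsto_nhds_unique (continuous_fst.continuousAt.tendsto.comp (hw τ hτ).1)
        (((chartAt E x₀).continuousAt hsrc).tendsto.comp (hη τ hτ.1))
    refine ⟨fun τ ↦ (w τ).2, ?_, ?_, continuous_snd.continuousAt.tendsto.comp (hw t htI).1⟩
    · filter_upwards [hIn t htI] with τ hτ
      have h1 : HasDerivWithinAt (fun τ ↦ (w τ).1) (w τ).2 I τ :=
        (ContinuousLinearMap.fst ℝ E E).hasFDerivAt.comp_hasDerivWithinAt τ (hw τ hτ).2
      exact (h1.congr (fun σ hσ ↦ (hw1 σ hσ).symm) (hw1 τ hτ).symm).mono_of_mem_nhdsWithin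
        (hIn τ hτ)
    · have h1 : HasDerivWithinAt (fun τ ↦ (w τ).2)
          (transportField E x₀ (w t).1 (w t).2 (w t).2) I t :=
        (ContinuousLinearMap.snd ℝ E E).hasFDerivAt.comp_hasDerivWithinAt t (hw t htI).2
      rw [hw1 t htI] at h1
      exact h1.mono_of_mem_nhdsWithin (hIn t htI)
  have hgeo : IsGeodesicOn (E := E) η (Icc 0 1) := by
    refine (isGeodesicOn_iff u01).2 ⟨hηc, fun t ht x₀ hx ↦ ?_⟩
    obtain ⟨W, h1, h2, -⟩ := key t ht x₀ hx
    exact ⟨W, h1, h2⟩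
  have h0 : (0 : ℝ) ∈ Icc (0 : ℝ) 1 := by simp
  have hsrc : η 0 ∈ (chartAt E a).source := hη0 ▸ mem_chart_source E a
  have hvel : Tendsto (fun k ↦ tangentCoord a (velocity (E := E) (γ k) (Icc 0 1) 0)) U
      (𝓝 (tangentCoord a (velocity (E := E) η (Icc 0 1) 0))) := by
    obtain ⟨W, h1, -, h3⟩ := key 0 h0 a hsrc
    rwa [tangentCoord_velocity hsrc (u01 0 h0) (hgeo.mdifferentiableWithinAt h0),
      (h1.self_of_nhdsWithin h0).derivWithin (u01 0 h0)]
  refine ⟨η, ⟨hgeo, hη0, hη1, ?_⟩, hvel⟩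
  have hnorm : ∀ {ζ : ℝ → M}, ζ 0 = a →
      metricCLM E a (chartAt E a a) (tangentCoord a (velocity (E := E) ζ (Icc 0 1) 0))
        (tangentCoord a (velocity (E := E) ζ (Icc 0 1) 0))
        = ‖(velocity (E := E) ζ (Icc 0 1) 0).2‖ ^ 2 := by
    intro ζ hζ
    have hs : ζ 0 ∈ (chartAt E a).source := hζ ▸ mem_chart_source E a
    rw [metricCLM_apply ((chartAt E a).map_source (mem_chart_source E a)),
      ← metricInChart_tangentCoord_self (p := velocity (E := E) ζ (Icc 0 1) 0) hs]
    exact congrArg (fun x ↦ metricInChart a (chartAt E a x) _ _) hζ.symm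
  have hG : Continuous fun v : E ↦ metricCLM E a (chartAt E a a) v v :=
    (metricCLM E a (chartAt E a a)).continuous.clm_apply continuous_id
  have h1 := (hG.tendsto _).comp hvel
  simp only [Function.comp_def, hnorm (hγ _).2.1, hnorm hη0, (hγ _).2.2.2] at h1
  have h2 := tendsto_nhds_unique h1 (hd.pow 2)
  exact (sq_eq_sq₀ (norm_nonneg _) dist_nonneg).1 h2

end Limits

section InnerProductSpace

variable {F : Type*} [NormedAddCommGroup F] [InnerProductSpace ℝ F]

lemma tangentCoord_vectorSpace (x₀ : F) (p : TangentBundle 𝓘(ℝ, F) F) :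
    tangentCoord x₀ p = p.2 := by
  unfold tangentCoord
  rw [trivializationAt_model_space_apply]

lemma metricInChart_vectorSpace (x₀ p v w : F) : metricInChart x₀ p v w = inner ℝ v w := by
  have h := metricInChart_tangentCoord (x₀ := x₀) (mem_univ p : p ∈ (chartAt F x₀).source) v w
  rw [tangentCoord_vectorSpace, tangentCoord_vectorSpace] at h
  exact h

variable [FiniteDimensional ℝ F]

lemma transportField_vectorSpace (x₀ p v w : F) : transportField F x₀ p v w = 0 := by
  have h : christoffelCLM F x₀ p v w = 0 := by
    ext z
    rw [christoffelCLM_apply (mem_univ p : p ∈ (chartAt F x₀).target)]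
    simp [christoffel, metricInChart_vectorSpace]
  rw [transportField, h, map_zero, neg_zero]

lemma isParallelOn_vectorSpace_iff {V : ℝ → TangentBundle 𝓘(ℝ, F) F} {s : Set ℝ} :
    IsParallelOn V s ↔ ∀ t ∈ s, DifferentiableWithinAt ℝ (fun τ ↦ (V τ).proj) s t ∧
      DifferentiableWithinAt ℝ (fun τ ↦ ((V τ).2 : F)) s t ∧
      derivWithin (fun τ ↦ ((V τ).2 : F)) s t = 0 := by
  rw [isParallelOn_iff]
  simp only [tangentCoord_vectorSpace]
  refine forall₂_congr fun t _ ↦ ⟨fun h ↦ ?_, fun h x₀ _ ↦ ?_⟩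
  · obtain ⟨⟨-, h1⟩, h2, h3⟩ := h 0 (mem_univ _)
    exact ⟨h1, h2, h3.trans (transportField_vectorSpace ..)⟩
  · exact ⟨⟨h.1.continuousWithinAt, h.1⟩, h.2.1, h.2.2.trans (transportField_vectorSpace ..).symm⟩

lemma IsParallelOn.snd_eq_vectorSpace {V : ℝ → TangentBundle 𝓘(ℝ, F) F} {a b : ℝ}
    (h : IsParallelOn V (Icc a b)) {t : ℝ} (ht : t ∈ Icc a b) : ((V t).2 : F) = (V a).2 := by
  rw [isParallelOn_vectorSpace_iff] at h
  exact constant_of_derivWithin_zero (f := fun τ ↦ ((V τ).2 : F)) (fun τ hτ ↦ (h τ hτ).2.1)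
    (fun τ hτ ↦ (h τ ⟨hτ.1, hτ.2.le⟩).2.2) t ht

lemma isMinGeodesic_line (a b : F) :
    IsMinGeodesic (E := F) (fun t : ℝ ↦ a + t • (b - a)) a b ∧
      velocity (E := F) (fun t : ℝ ↦ a + t • (b - a)) (Icc 0 1) 0 = ⟨a, b - a⟩ := by
  have u := uniqueDiffOn_Icc (zero_lt_one (α := ℝ))
  have hd : ∀ t : ℝ, HasDerivWithinAt (fun t : ℝ ↦ a + t • (b - a)) (b - a) (Icc 0 1) t :=
    fun t ↦ by simpa using (((hasDerivWithinAt_id t _).smul_const (b - a)).const_add a)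
  have hg : IsGeodesicOn (E := F) (fun t : ℝ ↦ a + t • (b - a)) (Icc 0 1) := by
    refine (isGeodesicOn_iff u).2 ⟨fun t _ ↦ (hd t).continuousWithinAt, fun t ht x₀ hx ↦
      ⟨fun _ ↦ b - a, Eventually.of_forall fun τ ↦ hd τ, ?_⟩⟩
    rw [transportField_vectorSpace]
    exact hasDerivWithinAt_const _ _ _
  have h0 : (0 : ℝ) ∈ Icc (0 : ℝ) 1 := by simp
  have hv : velocity (E := F) (fun t : ℝ ↦ a + t • (b - a)) (Icc 0 1) 0 = ⟨a, b - a⟩ := by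
    refine tangentBundle_ext_of_tangentCoord (x₀ := a) (mem_univ _) (by simp [velocity]) ?_
    have h := hg.hasDerivWithinAt_chart u h0 (x₀ := a) (mem_univ _)
    rw [tangentCoord_vectorSpace a ⟨a, b - a⟩]
    rw [← h.derivWithin (u 0 h0)]
    exact (hd 0).derivWithin (u 0 h0)
  refine ⟨isMinGeodesic_iff.2 ⟨hg, by simp, by simp, ?_⟩, hv⟩
  rw [hv, norm_tangentSpace_vectorSpace, dist_comm, dist_eq_norm]

lemma mem_logSet_vectorSpace_iff {a b z : F} : z ∈ logSet (E := F) a b ↔ z = b - a := by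
  have u := uniqueDiffOn_Icc (zero_lt_one (α := ℝ))
  constructor
  · rintro ⟨γ, hγ, hv⟩
    obtain ⟨hg, h0, h1, -⟩ := isMinGeodesic_iff.1 hγ
    have hd : ∀ t ∈ Icc (0 : ℝ) 1, HasDerivWithinAt (fun τ ↦ γ τ - τ • z) 0 (Icc 0 1) t := by
      intro t ht
      have h := hg.hasDerivWithinAt_chart u ht (x₀ := a) (mem_univ _)
      rw [tangentCoord_vectorSpace] at h
      have h2 := IsParallelOn.snd_eq_vectorSpace hg ht
      have h3 : HasDerivWithinAt γ z (Icc 0 1) t := by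
        rw [hv] at h2
        exact h.congr_deriv h2
      exact (h3.sub ((hasDerivWithinAt_id t _).smul_const z)).congr_deriv (by simp)
    have := constant_of_derivWithin_zero (fun t ht ↦ (hd t ht).differentiableWithinAt)
      (fun t ht ↦ (hd t ⟨ht.1, ht.2.le⟩).derivWithin (u t ⟨ht.1, ht.2.le⟩)) 1
      (right_mem_Icc.2 zero_le_one)
    simp only [h0, h1, one_smul, zero_smul, sub_zero] at this
    rw [← this, sub_sub_cancel]
  · rintro rfl
    exact ⟨_, isMinGeodesic_line a b⟩

lemma mem_ptSet_vectorSpace_iff {a b v z : F} : z ∈ ptSet (E := F) a b v ↔ z = v := by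
  constructor
  · rintro ⟨γ, V, -, -, hV, h0, h1⟩
    have h := IsParallelOn.snd_eq_vectorSpace hV (right_mem_Icc.2 zero_le_one)
    rw [h0, h1] at h
    exact h
  · rintro rfl
    have hl := (isMinGeodesic_line a b).1
    refine ⟨_, fun t ↦ ⟨a + t • (b - a), z⟩, hl, fun t _ ↦ rfl, ?_, ?_, ?_⟩
    · refine isParallelOn_vectorSpace_iff.2 fun t ht ↦ ⟨?_, differentiableWithinAt_const z, ?_⟩
      · exact ((isParallelOn_vectorSpace_iff.1 hl.1) t ht).1
      · exact (hasDerivWithinAt_const t _ z).derivWithin (uniqueDiffOn_Icc zero_lt_one t ht)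
    · change (⟨a + (0 : ℝ) • (b - a), z⟩ : TangentBundle 𝓘(ℝ, F) F) = ⟨a, z⟩
      rw [zero_smul, add_zero]
    · change (⟨a + (1 : ℝ) • (b - a), z⟩ : TangentBundle 𝓘(ℝ, F) F) = ⟨b, z⟩
      rw [one_smul, add_sub_cancel]

lemma Dpt_vectorSpace (x y u v : F) : Dpt F x y u v = ‖(y - x) - (v - u)‖ₑ := by
  refine le_antisymm ?_ ?_
  · refine (iInf₂_le (y - x) (mem_logSet_vectorSpace_iff.2 rfl)).trans
      ((iInf₂_le (v - u) (mem_logSet_vectorSpace_iff.2 rfl)).trans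
        ((iInf₂_le (v - u) (mem_ptSet_vectorSpace_iff.2 rfl)).trans_eq ?_))
    exact enorm_tangentSpace_vectorSpace
  · refine le_iInf₂ fun z₁ h₁ ↦ le_iInf₂ fun w hw ↦ le_iInf₂ fun z₂ h₂ ↦ ?_
    have e₁ := mem_logSet_vectorSpace_iff (F := F) (z := (z₁ : F)) |>.1 h₁
    have e₂ := (mem_ptSet_vectorSpace_iff (F := F) (v := (w : F)) (z := (z₂ : F)) |>.1 h₂).trans
      (mem_logSet_vectorSpace_iff (F := F) (z := (w : F)) |>.1 hw)
    rw [← e₁, ← e₂]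
    exact enorm_tangentSpace_vectorSpace.ge

lemma ptTV2_vectorSpace (n : ℕ) (u : ℕ → F) :
    ptTV2 F n u = ENNReal.ofReal (vecTV2 n u) := by
  unfold ptTV2 vecTV2
  rw [ENNReal.ofReal_sum_of_nonneg fun _ _ ↦ norm_nonneg _]
  refine Finset.sum_congr rfl fun i _ ↦ ?_
  rw [Dpt_vectorSpace, ofReal_norm, two_nsmul]
  congr 1
  abel

lemma ptCost_vectorSpace (α₀ α₁ : ℝ≥0) (n : ℕ) (u w : ℕ → F) :
    ptCost F α₀ α₁ n u (fun i ↦ u i + w i)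
      = ENNReal.ofReal ((∑ i ∈ Finset.range n, (α₁ : ℝ) * ‖(u (i + 1) - u i) - w i‖)
        + ∑ i ∈ Finset.range (n - 1), (α₀ : ℝ) * ‖w (i + 1) - w i‖) := by
  have h : ∀ (α : ℝ≥0) (x : F), ENNReal.ofReal (α * ‖x‖) = α * ‖x‖ₑ := fun α x ↦ by
    rw [ENNReal.ofReal_mul α.coe_nonneg, ofReal_norm, ENNReal.ofReal_coe_nnreal]
  rw [ENNReal.ofReal_add (by positivity) (by positivity),
    ENNReal.ofReal_sum_of_nonneg fun _ _ ↦ by positivity,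
    ENNReal.ofReal_sum_of_nonneg fun _ _ ↦ by positivity]
  simp only [h, ptCost, Dpt_vectorSpace, add_sub_cancel_left, edist_eq_enorm_sub, sub_sub]

lemma ptTGV_vectorSpace (α₀ α₁ : ℝ≥0) (n : ℕ) (u : ℕ → F) :
    ptTGV F α₀ α₁ n u = ENNReal.ofReal (vecTGV α₀ α₁ n u) := by
  unfold ptTGV vecTGV
  rw [← (Equiv.addLeft u).iInf_comp]
  simp only [Equiv.coe_addLeft]
  change ⨅ w : ℕ → F, ptCost F α₀ α₁ n u (fun i ↦ u i + w i) = _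
  simp only [ptCost_vectorSpace]
  exact (ENNReal.ofReal_iInf _).symm

end InnerProductSpace

section Signals

variable {E : Type*} [NormedAddCommGroup E] [NormedSpace ℝ E]
  {M : Type*} [MetricSpace M] [ChartedSpace E M]

lemma exists_velocity_eq {γ : ℝ → M} {s : Set ℝ} {t : ℝ} {a : M} (h : γ t = a) :
    ∃ v, velocity (E := E) γ s t = ⟨a, v⟩ := by
  subst h
  exact ⟨_, rfl⟩

section

variable [RiemannianBundle (fun x : M ↦ TangentSpace 𝓘(ℝ, E) x)]

lemma norm_sub_congr {x a : M} {X Y : TangentSpace 𝓘(ℝ, E) x} {v w : TangentSpace 𝓘(ℝ, E) a}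
    (hX : (⟨x, X⟩ : TangentBundle 𝓘(ℝ, E) M) = ⟨a, v⟩)
    (hY : (⟨x, Y⟩ : TangentBundle 𝓘(ℝ, E) M) = ⟨a, w⟩) : ‖X - Y‖ = ‖v - w‖ := by
  obtain rfl : x = a := congrArg TotalSpace.proj hX
  rw [TotalSpace.mk_inj.1 hX, TotalSpace.mk_inj.1 hY]

lemma norm_snd_congr {p : TangentBundle 𝓘(ℝ, E) M} {a : M} {v : TangentSpace 𝓘(ℝ, E) a}
    (h : p = ⟨a, v⟩) : ‖p.2‖ = ‖v‖ := by
  rw [h]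

end

variable [IsManifold 𝓘(ℝ, E) ∞ M]

lemma velocity_comp_add_const {γ : ℝ → M} {s s' : Set ℝ} (hs : UniqueDiffOn ℝ s)
    (hs' : UniqueDiffOn ℝ s') {l : ℝ} (hm : MapsTo (fun τ ↦ τ + l) s' s) {t : ℝ}
    (ht : t ∈ s') (hγ : MDifferentiableWithinAt 𝓘(ℝ, ℝ) 𝓘(ℝ, E) γ s (t + l)) :
    velocity (E := E) (fun τ ↦ γ (τ + l)) s' t = velocity γ s (t + l) := by
  have h := velocity_comp_affine (k := 1) (l := l) hs hs' (by simpa only [one_mul] using hm) ht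
    (by simpa only [one_mul] using hγ)
  rw [one_smul] at h
  simp only [one_mul] at h ⊢
  refine h.trans ?_
  change velocity γ s (1 * t + l) = velocity γ s (t + l)
  rw [one_mul]

variable [RiemannianBundle (fun x : M ↦ TangentSpace 𝓘(ℝ, E) x)]

lemma norm_velocity_comp_affine {γ : ℝ → M} {s s' : Set ℝ} (hs : UniqueDiffOn ℝ s)
    (hs' : UniqueDiffOn ℝ s') {k l : ℝ} (hm : MapsTo (fun τ ↦ k * τ + l) s' s) {t : ℝ}
    (ht : t ∈ s') (hγ : MDifferentiableWithinAt 𝓘(ℝ, ℝ) 𝓘(ℝ, E) γ s (k * t + l)) :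
    ‖(velocity (E := E) (fun τ ↦ γ (k * τ + l)) s' t).2‖
      = |k| * ‖(velocity (E := E) γ s (k * t + l)).2‖ := by
  let v : TangentSpace 𝓘(ℝ, E) (γ (k * t + l)) := (velocity (E := E) γ s (k * t + l)).2
  have h : velocity (E := E) (fun τ ↦ γ (k * τ + l)) s' t = ⟨γ (k * t + l), k • v⟩ :=
    velocity_comp_affine hs hs' hm ht hγ
  exact (norm_snd_congr h).trans (norm_smul k v)

lemma tendsto_norm_sub_of_tendsto_tangentCoord {ι : Type*} {l : Filter ι} {a : M}
    {w : ι → TangentSpace 𝓘(ℝ, E) a} {v : TangentSpace 𝓘(ℝ, E) a}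
    (h : Tendsto (fun k ↦ tangentCoord a ⟨a, w k⟩) l (𝓝 (tangentCoord a ⟨a, v⟩))) :
    Tendsto (fun k ↦ ‖w k - v‖) l (𝓝 0) := by
  have hx := mem_chart_source E a
  have hp := (chartAt E a).map_source hx
  let e := trivializationAt E (TangentSpace 𝓘(ℝ, E) : M → Type _) a
  have hsub : ∀ x y : TangentSpace 𝓘(ℝ, E) a,
      tangentCoord a ⟨a, x - y⟩ = tangentCoord a ⟨a, x⟩ - tangentCoord a ⟨a, y⟩ := fun x y ↦ by
    have h1 := e.continuousLinearMapAt_apply_of_mem (R := ℝ) hx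
    unfold tangentCoord
    rw [← h1, ← h1, ← h1, map_sub]
  have hG : Continuous fun z : E ↦ metricCLM E a (chartAt E a a) z z :=
    (metricCLM E a (chartAt E a a)).continuous.clm_apply continuous_id
  have h2 := (hG.tendsto _).comp (h.sub_const (tangentCoord a ⟨a, v⟩))
  have h3 : ∀ k, (fun z : E ↦ metricCLM E a (chartAt E a a) z z)
      (tangentCoord a ⟨a, w k⟩ - tangentCoord a ⟨a, v⟩) = ‖w k - v‖ ^ 2 := fun k ↦ by
    simp only
    rw [← hsub, metricCLM_apply hp]
    exact metricInChart_tangentCoord_self (p := ⟨a, w k - v⟩) hx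
  simp only [Function.comp_def, h3] at h2
  simpa using h2.sqrt

lemma ptCost_succ (α₀ α₁ : ℝ≥0) (n : ℕ) (u : ℕ → M) :
    ptCost E α₀ α₁ n u (fun i ↦ u (i + 1)) = α₀ * ptTV2 E n u := by
  simp [ptCost, ptTV2, Finset.mul_sum]

lemma ptTGV_eq_of_forall_le {α₀ α₁ : ℝ≥0} {n : ℕ} {u : ℕ → M}
    (h : ∀ y : ℕ → M, ptCost E α₀ α₁ n u (fun i ↦ u (i + 1)) ≤ ptCost E α₀ α₁ n u y) :
    ptTGV E α₀ α₁ n u = α₀ * ptTV2 E n u :=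
  (ptCost_succ (E := E) α₀ α₁ n u) ▸ le_antisymm (iInf_le _ _) (le_iInf h)

variable [IsContMDiffRiemannianBundle 𝓘(ℝ, E) ∞ E (fun x : M ↦ TangentSpace 𝓘(ℝ, E) x)]
  [FiniteDimensional ℝ E]

lemma IsGeodesicOn.comp_add_const {γ : ℝ → M} {s s' : Set ℝ} (h : IsGeodesicOn (E := E) γ s)
    (hs : UniqueDiffOn ℝ s) (hs' : UniqueDiffOn ℝ s') {l : ℝ}
    (hm : MapsTo (fun τ ↦ τ + l) s' s) : IsGeodesicOn (E := E) (fun τ ↦ γ (τ + l)) s' := by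
  simpa only [one_mul] using h.comp_affine (k := 1) (l := l) hs hs'
    (by simpa only [one_mul] using hm)

lemma IsParallelOn.congr {V V' : ℝ → TangentBundle 𝓘(ℝ, E) M} {s : Set ℝ} (h : IsParallelOn V s)
    (hV : EqOn V' V s) : IsParallelOn V' s := by
  rw [isParallelOn_iff] at h ⊢
  intro t ht x₀ hx
  have e₁ : EqOn (fun τ ↦ (V' τ).proj) (fun τ ↦ (V τ).proj) s := fun τ hτ ↦
    congrArg TotalSpace.proj (hV hτ)
  have e₂ : EqOn (fun τ ↦ chartAt E x₀ (V' τ).proj) (fun τ ↦ chartAt E x₀ (V τ).proj) s :=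
    fun τ hτ ↦ congrArg _ (e₁ hτ)
  have e₃ : EqOn (fun τ ↦ tangentCoord x₀ (V' τ)) (fun τ ↦ tangentCoord x₀ (V τ)) s :=
    fun τ hτ ↦ congrArg _ (hV hτ)
  rw [hV ht] at hx
  obtain ⟨⟨h1, h2⟩, h3, h4⟩ := h t ht x₀ hx
  refine ⟨⟨h1.congr e₁ (e₁ ht), h2.congr e₂ (e₂ ht)⟩, h3.congr e₃ (e₃ ht), ?_⟩
  rw [derivWithin_congr e₃ (e₃ ht), derivWithin_congr e₂ (e₂ ht), hV ht, h4]

/-- Parallel transport along a curve is isometric. -/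
lemma norm_sub_eq_of_isParallelOn_of_proj_eq {V V' : ℝ → TangentBundle 𝓘(ℝ, E) M} {s t : ℝ}
    (hst : s ≤ t) (hV : IsParallelOn V (Icc s t)) (hV' : IsParallelOn V' (Icc s t))
    (hp : ∀ τ ∈ Icc s t, (V' τ).proj = (V τ).proj) {a b : M}
    {v v' : TangentSpace 𝓘(ℝ, E) a} {w w' : TangentSpace 𝓘(ℝ, E) b}
    (hv : V s = ⟨a, v⟩) (hv' : V' s = ⟨a, v'⟩) (hw : V t = ⟨b, w⟩) (hw' : V' t = ⟨b, w'⟩) :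
    ‖w - w'‖ = ‖v - v'‖ := by
  classical
  let Y : ∀ τ, TangentSpace 𝓘(ℝ, E) (V τ).proj := fun τ ↦
    if h : (V' τ).proj = (V τ).proj then h ▸ (V' τ).2 else 0
  have hY : EqOn (fun τ ↦ (⟨(V τ).proj, Y τ⟩ : TangentBundle 𝓘(ℝ, E) M)) V' (Icc s t) := by
    intro τ hτ
    have key : ∀ (x : M) (p : TangentBundle 𝓘(ℝ, E) M) (h : p.proj = x),
        (⟨x, h ▸ p.2⟩ : TangentBundle 𝓘(ℝ, E) M) = p := by
      rintro x p rfl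
      rfl
    simp only [Y, dif_pos (hp τ hτ)]
    exact key _ _ _
  have h := norm_sub_eq_of_isParallelOn (γ := fun τ ↦ (V τ).proj) (X := fun τ ↦ (V τ).2) (Y := Y)
    hV (hV'.congr hY) (right_mem_Icc.2 hst)
  rw [norm_sub_congr hw ((hY (right_mem_Icc.2 hst)).trans hw'),
    norm_sub_congr hv ((hY (left_mem_Icc.2 hst)).trans hv')] at h
  exact h

section Forward

/-- For three points on a geodesic at equal consecutive distances which it realizes, the parallel
transport of the first logarithm agrees with the second one. -/
lemma Dpt_eq_zero_of_isGeodesicOn {Γ : ℝ → M} (h : IsGeodesicOn (E := E) Γ (Icc 0 2))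
    (h₁ : ‖(velocity (E := E) Γ (Icc 0 2) 0).2‖ = dist (Γ 0) (Γ 1))
    (h₂ : ‖(velocity (E := E) Γ (Icc 0 2) 0).2‖ = dist (Γ 1) (Γ 2)) :
    Dpt E (Γ 1) (Γ 2) (Γ 0) (Γ 1) = 0 := by
  have u₂ := uniqueDiffOn_Icc (zero_lt_two (α := ℝ))
  have u₁ := uniqueDiffOn_Icc (zero_lt_one (α := ℝ))
  have hsub : Icc (0 : ℝ) 1 ⊆ Icc 0 2 := Icc_subset_Icc le_rfl one_le_two
  have hm : MapsTo (fun τ : ℝ ↦ τ + 1) (Icc 0 1) (Icc 0 2) := fun τ hτ ↦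
    ⟨by linarith [hτ.1], by linarith [hτ.2]⟩
  have m0 : (0 : ℝ) ∈ Icc (0 : ℝ) 1 := by simp
  have m1 : (1 : ℝ) ∈ Icc (0 : ℝ) 1 := by simp
  have hg₁ := h.mono u₂ u₁ hsub
  have hg₂ := h.comp_add_const u₂ u₁ hm
  have v₀ := h.velocity_mono u₂ u₁ hsub m0
  have v₁ := h.velocity_mono u₂ u₁ hsub m1
  have v₂ := velocity_comp_add_const u₂ u₁ hm m0 (h.mdifferentiableWithinAt (hm m0))
  have hmin₁ : IsMinGeodesic (E := E) Γ (Γ 0) (Γ 1) :=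
    isMinGeodesic_iff.2 ⟨hg₁, rfl, rfl, by rw [v₀, h₁]⟩
  have hmin₂ : IsMinGeodesic (E := E) (fun τ ↦ Γ (τ + 1)) (Γ 1) (Γ 2) := by
    refine isMinGeodesic_iff.2 ⟨hg₂, by simp, by norm_num, ?_⟩
    rw [v₂, ← h₂, h.norm_velocity_eq (hm m0)]
  rw [zero_add] at v₂
  refine le_antisymm ?_ bot_le
  refine (iInf₂_le (velocity Γ (Icc 0 2) 1).2 ⟨_, hmin₂, v₂⟩).trans
    ((iInf₂_le (velocity Γ (Icc 0 2) 0).2 ⟨_, hmin₁, v₀⟩).trans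
      ((iInf₂_le (velocity Γ (Icc 0 2) 1).2
        ⟨Γ, velocity Γ (Icc 0 1), hmin₁, fun _ _ ↦ rfl, hg₁, v₀, v₁⟩).trans ?_))
  exact (enorm_eq_zero.2 (sub_self (velocity (E := E) Γ (Icc 0 2) 1).2)).le

lemma Dpt_eq_zero_of_isGeodesicSeq {u : ℕ → M} (h : IsGeodesicSeq E 2 u) :
    Dpt E (u 1) (u 2) (u 0) (u 1) = 0 := by
  obtain ⟨L, γ, hL, hγ, hv, hu, hd⟩ := h
  have hu0 := hu 0 (by norm_num)
  have hu1 := hu 1 (by norm_num)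
  have hu2 := hu 2 le_rfl
  have hd0 := hd 0 (by norm_num)
  have hd1 := hd 1 (by norm_num)
  push_cast at hu0 hu1 hu2 hd0 hd1
  have m0 : (0 : ℝ) ∈ Icc (0 : ℝ) 2 := by simp
  rcases hL.eq_or_lt with rfl | hL
  · simp only [mul_zero, zero_div] at hu0 hu1 hu2
    have h := Dpt_eq_zero_of_isGeodesicOn (isGeodesicOn_const (E := E) (γ 0) (Icc 0 2)) ?_ ?_
    · simpa only [hu0, ← hu1, ← hu2] using h
    all_goals
      rw [dist_self, norm_eq_zero]
      unfold velocity
      simp only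
      rw [mfderivWithin_const]
      rfl
  · have u₂ := uniqueDiffOn_Icc (zero_lt_two (α := ℝ))
    have uL := uniqueDiffOn_Icc hL
    have hm : MapsTo (fun τ : ℝ ↦ L / 2 * τ + 0) (Icc 0 2) (Icc 0 L) := fun τ hτ ↦
      ⟨by nlinarith [hτ.1], by nlinarith [hτ.2]⟩
    have hn : ‖(velocity (E := E) (fun τ ↦ γ (L / 2 * τ + 0)) (Icc 0 2) 0).2‖ = L / 2 := by
      rw [norm_velocity_comp_affine uL u₂ hm m0 (hγ.mdifferentiableWithinAt (hm m0)),
        hv hL _ (hm m0), mul_one, abs_of_nonneg (by linarith)]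
    have e0 : γ (L / 2 * 0 + 0) = u 0 := by rw [← hu0]; congr 1; ring
    have e1 : γ (L / 2 * 1 + 0) = u 1 := by rw [← hu1]; congr 1; ring
    have e2 : γ (L / 2 * 2 + 0) = u 2 := by rw [← hu2]; congr 1; ring
    have h := Dpt_eq_zero_of_isGeodesicOn (hγ.comp_affine uL u₂ hm) (by rw [hn, e0, e1]; exact hd0.symm)
      (by rw [hn, e1, e2]; exact hd1.symm)
    rwa [e0, e1, e2] at h

lemma ptTGV_eq_zero_of_isLocallyGeodesicSeq (α₀ α₁ : ℝ≥0) {n : ℕ} {u : ℕ → M}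
    (h : IsLocallyGeodesicSeq E n u) : ptTGV E α₀ α₁ n u = 0 := by
  refine le_antisymm ((iInf_le _ fun i ↦ u (i + 1)).trans_eq ?_) bot_le
  rw [ptCost_succ, ptTV2, Finset.sum_eq_zero, mul_zero]
  intro i hi
  exact Dpt_eq_zero_of_isGeodesicSeq (h i (by have := Finset.mem_range.1 hi; omega))

end Forward

section Backward

/-- Minimizing geodesics between consecutive points with matching velocities form one geodesic. -/
lemma exists_isGeodesicOn_of_velocity_eq {u : ℕ → M} {γ : ℕ → ℝ → M} (m : ℕ)
    (hγ : ∀ i ≤ m, IsMinGeodesic (E := E) (γ i) (u i) (u (i + 1)))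
    (hv : ∀ i < m, velocity (E := E) (γ i) (Icc 0 1) 1 = velocity (γ (i + 1)) (Icc 0 1) 0) :
    ∃ Γ : ℝ → M, IsGeodesicOn (E := E) Γ (Icc 0 (m + 1)) ∧ (∀ i ≤ m + 1, Γ i = u i) ∧
      velocity (E := E) Γ (Icc 0 (m + 1)) (m + 1) = velocity (γ m) (Icc 0 1) 1 ∧
      ∀ i ≤ m, ‖(velocity (E := E) Γ (Icc 0 (m + 1)) 0).2‖ = dist (u i) (u (i + 1)) := by
  have u01 := uniqueDiffOn_Icc (zero_lt_one (α := ℝ))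
  have m0 : (0 : ℝ) ∈ Icc (0 : ℝ) 1 := by simp
  have m1 : (1 : ℝ) ∈ Icc (0 : ℝ) 1 := by simp
  induction m with
  | zero =>
    obtain ⟨h1, h2, h3, h4⟩ := isMinGeodesic_iff.1 (hγ 0 le_rfl)
    have e : ((0 : ℕ) : ℝ) + 1 = 1 := by simp
    rw [e]
    refine ⟨γ 0, h1, fun i hi ↦ ?_, rfl, fun i hi ↦ ?_⟩
    · interval_cases i <;> simp [h2, h3]
    · obtain rfl : i = 0 := by omega
      exact h4
  | succ m ih =>
    obtain ⟨Γ, hΓ, hΓu, hΓv, hΓn⟩ := ih (fun i hi ↦ hγ i (by omega)) (fun i hi ↦ hv i (by omega))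
    obtain ⟨h1, h2, h3, h4⟩ := isMinGeodesic_iff.1 (hγ (m + 1) le_rfl)
    rw [show ((m + 1 : ℕ) : ℝ) = (m : ℝ) + 1 by push_cast; rfl]
    have hm0 : (0 : ℝ) ≤ m := m.cast_nonneg
    set N : ℝ := (m : ℝ) + 1 with hN
    have l₁ : (0 : ℝ) < N := by positivity
    have l₂ : N < N + 1 := by linarith
    have uA := uniqueDiffOn_Icc l₁
    have uB := uniqueDiffOn_Icc l₂
    have uC := uniqueDiffOn_Icc (l₁.trans l₂)
    have hmaps : MapsTo (fun τ ↦ τ + -N) (Icc N (N + 1)) (Icc 0 1) := fun τ hτ ↦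
      ⟨by linarith [hτ.1], by linarith [hτ.2]⟩
    have hγ₂ := h1.comp_add_const u01 uB hmaps
    have hvel : ∀ t ∈ Icc N (N + 1), velocity (E := E) (fun τ ↦ γ (m + 1) (τ + -N)) (Icc N (N + 1)) t
        = velocity (γ (m + 1)) (Icc 0 1) (t + -N) := fun t ht ↦
      velocity_comp_add_const u01 uB hmaps ht (h1.mdifferentiableWithinAt (hmaps ht))
    have mA : N ∈ Icc 0 N := ⟨l₁.le, le_rfl⟩
    have mB : N ∈ Icc N (N + 1) := ⟨le_rfl, l₂.le⟩
    have mB' : N + 1 ∈ Icc N (N + 1) := ⟨l₂.le, le_rfl⟩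
    have hmatch : velocity (E := E) Γ (Icc 0 N) N
        = velocity (fun τ ↦ γ (m + 1) (τ + -N)) (Icc N (N + 1)) N := by
      rw [hΓv, hvel N mB, add_neg_cancel, hv m (by omega)]
    have hglue := hΓ.ite l₁ l₂ hγ₂ hmatch
    set Γ' : ℝ → M := fun τ ↦ if τ ≤ N then Γ τ else γ (m + 1) (τ + -N) with hΓ'
    have e₁ : EqOn Γ' Γ (Icc 0 N) := fun τ hτ ↦ if_pos hτ.2
    have e₂ : EqOn Γ' (fun τ ↦ γ (m + 1) (τ + -N)) (Icc N (N + 1)) := by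
      intro τ hτ
      rcases hτ.1.eq_or_lt with rfl | h
      · exact (if_pos le_rfl).trans (congrArg TotalSpace.proj hmatch)
      · exact if_neg h.not_ge
    have sA : Icc 0 N ⊆ Icc 0 (N + 1) := Icc_subset_Icc le_rfl l₂.le
    have sB : Icc N (N + 1) ⊆ Icc 0 (N + 1) := Icc_subset_Icc l₁.le le_rfl
    have hend : velocity (E := E) Γ' (Icc 0 (N + 1)) (N + 1) = velocity (γ (m + 1)) (Icc 0 1) 1 := by
      rw [← hglue.velocity_mono uC uB sB mB', velocity_congr uB e₂ mB'
        ((hglue.mono uC uB sB).mdifferentiableWithinAt mB'), hvel _ mB', add_neg_cancel_comm]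
    have hstart : velocity (E := E) Γ' (Icc 0 (N + 1)) 0 = velocity Γ (Icc 0 N) 0 := by
      have mA0 : (0 : ℝ) ∈ Icc 0 N := ⟨le_rfl, l₁.le⟩
      rw [← hglue.velocity_mono uC uA sA mA0, velocity_congr uA e₁ mA0
        ((hglue.mono uC uA sA).mdifferentiableWithinAt mA0)]
    refine ⟨Γ', hglue, fun i hi ↦ ?_, hend, fun i hi ↦ ?_⟩
    · rcases Nat.lt_or_ge i (m + 2) with hi' | hi'
      · have hiN : (i : ℝ) ≤ N := by
          rw [hN]
          exact_mod_cast Nat.lt_succ_iff.1 hi'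
        rw [e₁ ⟨i.cast_nonneg, hiN⟩, hΓu i (by omega)]
      · obtain rfl : i = m + 1 + 1 := by omega
        have : ((m + 1 + 1 : ℕ) : ℝ) = N + 1 := by push_cast; rfl
        rw [this, e₂ mB']
        simp only [add_neg_cancel_comm]
        exact h3
    · rcases Nat.lt_or_ge i (m + 1) with hi' | hi'
      · rw [hstart]
        exact hΓn i (by omega)
      · obtain rfl : i = m + 1 := by omega
        rw [← hglue.norm_velocity_eq (sB mB'), hend, h1.norm_velocity_eq m1, h4]

variable [IsRiemannianManifold 𝓘(ℝ, E) M]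

lemma isGeodesicSeq_of_isGeodesicOn {u : ℕ → M} {Γ : ℝ → M} (m : ℕ)
    (hΓ : IsGeodesicOn (E := E) Γ (Icc 0 (m + 1))) (hu : ∀ i ≤ m + 1, Γ i = u i)
    (hd : ∀ i ≤ m, ‖(velocity (E := E) Γ (Icc 0 (m + 1)) 0).2‖ = dist (u i) (u (i + 1))) :
    IsGeodesicSeq E (m + 1) u := by
  set ℓ : ℝ := ‖(velocity (E := E) Γ (Icc 0 (m + 1)) 0).2‖ with hℓ
  have hmpos : (0 : ℝ) < (m : ℝ) + 1 := by positivity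
  have hℓ0 : 0 ≤ ℓ := norm_nonneg _
  rcases hℓ0.eq_or_lt with h0 | hpos
  · refine ⟨0, fun _ ↦ u 0, le_rfl, isGeodesicOn_const _ _, fun h ↦ absurd h (lt_irrefl 0),
      fun i hi ↦ ?_, fun i hi ↦ ?_⟩
    · have hi' : (i : ℝ) ≤ m + 1 := by exact_mod_cast hi
      have h := hΓ.dist_le (s := 0) (t := i) ⟨le_rfl, hmpos.le⟩ ⟨i.cast_nonneg, hi'⟩
      rw [← hℓ, ← h0, mul_zero] at h
      have h00 := hu 0 (by omega)
      rw [Nat.cast_zero] at h00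
      rw [← hu i hi, ← h00]
      exact dist_le_zero.1 h
    · rw [← hd i (by omega), ← h0, zero_div]
  · have hL : 0 < ((m : ℝ) + 1) * ℓ := mul_pos hmpos hpos
    have u₁ := uniqueDiffOn_Icc hmpos
    have uL := uniqueDiffOn_Icc hL
    have hm : MapsTo (fun τ : ℝ ↦ ℓ⁻¹ * τ + 0) (Icc 0 (((m : ℝ) + 1) * ℓ)) (Icc 0 ((m : ℝ) + 1)) := by
      intro τ hτ
      simp only [add_zero]
      refine ⟨mul_nonneg (inv_nonneg.2 hpos.le) hτ.1, ?_⟩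
      rw [inv_mul_le_iff₀ hpos, mul_comm]
      exact hτ.2
    refine ⟨((m : ℝ) + 1) * ℓ, fun τ ↦ Γ (ℓ⁻¹ * τ + 0), hL.le, hΓ.comp_affine u₁ uL hm,
      fun _ t ht ↦ ?_, fun i hi ↦ ?_, fun i hi ↦ ?_⟩
    · rw [norm_velocity_comp_affine u₁ uL hm ht (hΓ.mdifferentiableWithinAt (hm ht)),
        hΓ.norm_velocity_eq (hm ht), ← hℓ, abs_of_nonneg (inv_nonneg.2 hpos.le),
        inv_mul_cancel₀ hpos.ne']
    · rw [← hu i hi]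
      have hne := hpos.ne'
      push_cast
      rw [add_zero]
      field_simp
    · rw [← hd i (by omega)]
      push_cast
      field_simp

variable [CompleteSpace M]

/-- If the minimizing geodesic from `a` to `b` is unique, the logarithm is continuous there. -/
lemma tendsto_norm_sub_of_isMinGeodesic {ι : Type*} (U : Ultrafilter ι) {ζ : ι → ℝ → M}
    {γ : ℝ → M} {a b : M} {y : ι → M} (hζ : ∀ k, IsMinGeodesic (E := E) (ζ k) a (y k))
    (hy : Tendsto y U (𝓝 b))
    (hu : ∀ γ' : ℝ → M, IsMinGeodesic (E := E) γ' a b → EqOn γ' γ (Icc 0 1))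
    {w : ι → TangentSpace 𝓘(ℝ, E) a} {v : TangentSpace 𝓘(ℝ, E) a}
    (hw : ∀ k, velocity (ζ k) (Icc 0 1) 0 = ⟨a, w k⟩) (hv : velocity γ (Icc 0 1) 0 = ⟨a, v⟩) :
    Tendsto (fun k ↦ ‖w k - v‖) U (𝓝 0) := by
  obtain ⟨η, hη, hlim⟩ := exists_isMinGeodesic_of_tendsto U hζ hy
  have m0 : (0 : ℝ) ∈ Icc (0 : ℝ) 1 := by simp
  rw [velocity_congr (uniqueDiffOn_Icc zero_lt_one) (hu η hη) m0
    (hη.1.mdifferentiableWithinAt m0), hv] at hlim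
  simp only [hw] at hlim
  exact tendsto_norm_sub_of_tendsto_tangentCoord hlim

/-- If `D_pt` vanishes in the limit, the unique minimizing geodesics from `a` to `b` and from `b` to
`c` have the same velocity at `b`. -/
lemma velocity_eq_of_forall_exists_Dpt_lt {a b c : M} {γ₁ γ₂ : ℝ → M}
    (h₁ : IsMinGeodesic (E := E) γ₁ a b)
    (hu₁ : ∀ γ' : ℝ → M, IsMinGeodesic (E := E) γ' a b → EqOn γ' γ₁ (Icc 0 1))
    (h₂ : IsMinGeodesic (E := E) γ₂ b c)
    (hu₂ : ∀ γ' : ℝ → M, IsMinGeodesic (E := E) γ' b c → EqOn γ' γ₂ (Icc 0 1))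
    (h : ∀ ε : ℝ≥0∞, 0 < ε → ∃ p q : M, edist p b < ε ∧ edist q c < ε ∧ Dpt E b q a p < ε) :
    velocity (E := E) γ₁ (Icc 0 1) 1 = velocity γ₂ (Icc 0 1) 0 := by
  let ε : ℕ → ℝ≥0∞ := fun k ↦ (k : ℝ≥0∞)⁻¹
  have hε : Tendsto ε (hyperfilter ℕ : Filter ℕ) (𝓝 0) :=
    ENNReal.tendsto_inv_nat_nhds_zero.mono_left Nat.hyperfilter_le_atTop
  have h' : ∀ k : ℕ, ∃ (p q : M) (θ ζ g : ℝ → M) (V : ℝ → TangentBundle 𝓘(ℝ, E) M)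
      (w : TangentSpace 𝓘(ℝ, E) a) (z₁ z₂ : TangentSpace 𝓘(ℝ, E) b),
      edist p b < ε k ∧ edist q c < ε k ∧ ‖z₁ - z₂‖ₑ < ε k ∧
      (IsMinGeodesic (E := E) ζ b q ∧ velocity ζ (Icc 0 1) 0 = ⟨b, z₁⟩) ∧
      (IsMinGeodesic (E := E) θ a p ∧ velocity θ (Icc 0 1) 0 = ⟨a, w⟩) ∧
      IsMinGeodesic (E := E) g a b ∧ (∀ t ∈ Icc (0 : ℝ) 1, (V t).proj = g t) ∧
      IsParallelOn V (Icc 0 1) ∧ V 0 = ⟨a, w⟩ ∧ V 1 = ⟨b, z₂⟩ := by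
    intro k
    obtain ⟨p, q, hp, hq, hD⟩ := h (ε k) (ENNReal.inv_pos.2 (ENNReal.natCast_ne_top k))
    unfold Dpt at hD
    simp only [iInf_lt_iff] at hD
    obtain ⟨z₁, ⟨ζ, hζ⟩, w, ⟨θ, hθ⟩, z₂, ⟨g, V, hg⟩, hlt⟩ := hD
    exact ⟨p, q, θ, ζ, g, V, w, z₁, z₂, hp, hq, hlt, hζ, hθ, hg⟩
  choose p q θ ζ g V w z₁ z₂ hp hq hz hζ hθ hg hVg hV hV0 hV1 using h'
  have hpb : Tendsto p (hyperfilter ℕ : Filter ℕ) (𝓝 b) :=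
    tendsto_iff_edist_tendsto_0.2 (tendsto_of_tendsto_of_tendsto_of_le_of_le tendsto_const_nhds hε
      (fun _ ↦ bot_le) fun k ↦ (hp k).le)
  have hqc : Tendsto q (hyperfilter ℕ : Filter ℕ) (𝓝 c) :=
    tendsto_iff_edist_tendsto_0.2 (tendsto_of_tendsto_of_tendsto_of_le_of_le tendsto_const_nhds hε
      (fun _ ↦ bot_le) fun k ↦ (hq k).le)
  obtain ⟨v₀, hv₀⟩ := exists_velocity_eq (E := E) (s := Icc 0 1) h₁.2.1
  obtain ⟨v₁, hv₁⟩ := exists_velocity_eq (E := E) (s := Icc 0 1) h₁.2.2.1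
  obtain ⟨v₂, hv₂⟩ := exists_velocity_eq (E := E) (s := Icc 0 1) h₂.2.1
  have lim₁ := tendsto_norm_sub_of_isMinGeodesic (hyperfilter ℕ) (fun k ↦ (hθ k).1) hpb hu₁
    (fun k ↦ (hθ k).2) hv₀
  have lim₂ := tendsto_norm_sub_of_isMinGeodesic (hyperfilter ℕ) (fun k ↦ (hζ k).1) hqc hu₂
    (fun k ↦ (hζ k).2) hv₂
  have lim₃ : Tendsto (fun k ↦ ‖z₁ k - z₂ k‖) (hyperfilter ℕ : Filter ℕ) (𝓝 0) := by
    have h1 : Tendsto (fun k ↦ ‖z₁ k - z₂ k‖ₑ) (hyperfilter ℕ : Filter ℕ) (𝓝 0) :=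
      tendsto_of_tendsto_of_tendsto_of_le_of_le tendsto_const_nhds hε
        (fun _ ↦ bot_le) fun k ↦ (hz k).le
    have h2 := (ENNReal.continuousAt_toReal ENNReal.zero_ne_top).tendsto.comp h1
    simpa [Function.comp_def] using h2
  have hiso : ∀ k, ‖z₂ k - v₁‖ = ‖w k - v₀‖ := fun k ↦
    norm_sub_eq_of_isParallelOn_of_proj_eq zero_le_one (hV k) h₁.1
      (fun τ hτ ↦ ((hVg k τ hτ).trans (hu₁ _ (hg k) hτ)).symm) (hV0 k) hv₀ (hV1 k) hv₁
  have hle : ‖v₁ - v₂‖ ≤ 0 := by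
    refine ge_of_tendsto' (by simpa using (lim₁.add lim₃).add lim₂) fun k ↦ ?_
    calc ‖v₁ - v₂‖ = ‖-(z₂ k - v₁) - (z₁ k - z₂ k) + (z₁ k - v₂)‖ := by congr 1; abel
      _ ≤ ‖-(z₂ k - v₁) - (z₁ k - z₂ k)‖ + ‖z₁ k - v₂‖ := norm_add_le _ _
      _ ≤ ‖-(z₂ k - v₁)‖ + ‖z₁ k - z₂ k‖ + ‖z₁ k - v₂‖ := by gcongr; exact norm_sub_le _ _
      _ = ‖w k - v₀‖ + ‖z₁ k - z₂ k‖ + ‖z₁ k - v₂‖ := by rw [norm_neg, hiso]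
  rw [hv₁, hv₂, sub_eq_zero.1 (norm_le_zero_iff.1 hle)]

lemma isGeodesicSeq_of_ptTGV_eq_zero {α₀ α₁ : ℝ≥0} (hα₀ : 0 < α₀) (hα₁ : 0 < α₁) {n : ℕ}
    {u : ℕ → M} (h : ptTGV E α₀ α₁ n u = 0)
    (hu : ∀ i < n, HasUniqueMinGeodesic (E := E) (u i) (u (i + 1))) : IsGeodesicSeq E n u := by
  rcases n with _ | m
  · refine ⟨0, fun _ ↦ u 0, le_rfl, isGeodesicOn_const _ _, fun h ↦ absurd h (lt_irrefl 0),
      fun i hi ↦ ?_, fun i hi ↦ absurd hi (Nat.not_lt_zero i)⟩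
    rw [Nat.le_zero.1 hi]
  have hu' : ∀ i, ∃ γ : ℝ → M, i < m + 1 → IsMinGeodesic (E := E) γ (u i) (u (i + 1)) ∧
      ∀ γ' : ℝ → M, IsMinGeodesic (E := E) γ' (u i) (u (i + 1)) → EqOn γ' γ (Icc 0 1) := by
    intro i
    by_cases hi : i < m + 1
    · obtain ⟨γ, hγ⟩ := hu i hi
      exact ⟨γ, fun _ ↦ hγ⟩
    · exact ⟨fun _ ↦ u 0, fun h ↦ absurd h hi⟩
  choose γ hγ using hu'
  have hv : ∀ i < m, velocity (E := E) (γ i) (Icc 0 1) 1 = velocity (γ (i + 1)) (Icc 0 1) 0 := by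
    intro i hi
    refine velocity_eq_of_forall_exists_Dpt_lt (hγ i (by omega)).1 (hγ i (by omega)).2
      (hγ (i + 1) (by omega)).1 (hγ (i + 1) (by omega)).2 fun ε hε ↦ ?_
    have hα : 0 < (min α₀ α₁ : ℝ≥0) := lt_min hα₀ hα₁
    obtain ⟨y, hy⟩ := iInf_lt_iff.1 (show ptTGV E α₀ α₁ (m + 1) u < (min α₀ α₁ : ℝ≥0) * ε by
      rw [h]
      exact ENNReal.mul_pos (by exact_mod_cast hα.ne') hε.ne')
    have hlt : ∀ {α : ℝ≥0} {x : ℝ≥0∞}, min α₀ α₁ ≤ α → (α : ℝ≥0∞) * x ≤ ptCost E α₀ α₁ (m + 1) u y →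
        x < ε := by
      intro α x hαα hx
      by_contra! hεx
      exact absurd (hx.trans_lt hy) (not_lt.2 (by gcongr))
    have hdist : ∀ j < m + 1, edist (y j) (u (j + 1)) < ε := fun j hj ↦ by
      rw [edist_comm]
      exact hlt (min_le_right _ _) ((Finset.single_le_sum (f := fun j ↦ (α₁ : ℝ≥0∞)
        * edist (u (j + 1)) (y j)) (fun _ _ ↦ bot_le) (Finset.mem_range.2 hj)).trans le_self_add)
    refine ⟨y i, y (i + 1), hdist i (by omega), hdist (i + 1) (by omega), ?_⟩
    exact hlt (min_le_left _ _) ((Finset.single_le_sum (f := fun j ↦ (α₀ : ℝ≥0∞)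
      * Dpt E (u (j + 1)) (y (j + 1)) (u j) (y j)) (fun _ _ ↦ bot_le)
      (Finset.mem_range.2 (by omega))).trans le_add_self)
  obtain ⟨Γ, h1, h2, -, h3⟩ := exists_isGeodesicOn_of_velocity_eq m
    (fun i hi ↦ (hγ i (by omega)).1) hv
  exact isGeodesicSeq_of_isGeodesicOn m h1 h2 h3

end Backward

end Signals

end PTTGV

end

theorem theorem2p13
    {E : Type*} [NormedAddCommGroup E] [NormedSpace ℝ E] [FiniteDimensional ℝ E]
    {M : Type*} [MetricSpace M] [CompleteSpace M] [ChartedSpace E M] [IsManifold 𝓘(ℝ, E) ∞ M]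
    [RiemannianBundle (fun x : M ↦ TangentSpace 𝓘(ℝ, E) x)]
    [IsContMDiffRiemannianBundle 𝓘(ℝ, E) ∞ E (fun x : M ↦ TangentSpace 𝓘(ℝ, E) x)]
    [IsRiemannianManifold 𝓘(ℝ, E) M]
    (α₀ α₁ : ℝ≥0) (hα₀ : 0 < α₀) (hα₁ : 0 < α₁) :
    -- (M-P1): on `ℝ^K`, PT-TGV is the vector space TGV
    (∀ (K n : ℕ) (u : ℕ → EuclideanSpace ℝ (Fin K)),
      PTTGV.ptTGV (EuclideanSpace ℝ (Fin K)) α₀ α₁ n u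
        = ENNReal.ofReal (PTTGV.vecTGV α₀ α₁ n u)) ∧
    -- (M-P3): if `y_i = u_{i+1}` is a minimizer, then PT-TGV is `α₀` times the functional `ptTV2`,
    (∀ (n : ℕ) (u : ℕ → M),
      (∀ y : ℕ → M, PTTGV.ptCost E α₀ α₁ n u (fun i ↦ u (i + 1)) ≤ PTTGV.ptCost E α₀ α₁ n u y) →
      PTTGV.ptTGV E α₀ α₁ n u = α₀ * PTTGV.ptTV2 E n u) ∧
    -- which on `ℝ^K` is the second-order TV
    (∀ (K n : ℕ) (u : ℕ → EuclideanSpace ℝ (Fin K)),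
      PTTGV.ptTV2 (EuclideanSpace ℝ (Fin K)) n u = ENNReal.ofReal (PTTGV.vecTV2 n u)) ∧
    -- PT-TGV vanishes on locally geodesic signals
    (∀ (n : ℕ) (u : ℕ → M), PTTGV.IsLocallyGeodesicSeq E n u → PTTGV.ptTGV E α₀ α₁ n u = 0) ∧
    -- if PT-TGV vanishes and neighbouring points have unique minimizing geodesics, then the signal
    -- is geodesic
    (∀ (n : ℕ) (u : ℕ → M), PTTGV.ptTGV E α₀ α₁ n u = 0 →
      (∀ i ≤ n, ∀ j ≤ n, |(i : ℤ) - j| ≤ 1 → PTTGV.HasUniqueMinGeodesic (E := E) (u i) (u j)) →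
      PTTGV.IsGeodesicSeq E n u) := by
  exact ⟨fun K n u ↦ PTTGV.ptTGV_vectorSpace α₀ α₁ n u,
    fun n u h ↦ PTTGV.ptTGV_eq_of_forall_le h,
    fun K n u ↦ PTTGV.ptTV2_vectorSpace n u,
    fun n u h ↦ PTTGV.ptTGV_eq_zero_of_isLocallyGeodesicSeq α₀ α₁ h,
    fun n u h hu ↦ PTTGV.isGeodesicSeq_of_ptTGV_eq_zero hα₀ hα₁ h
      fun i hi ↦ hu i hi.le (i + 1) hi (by simp)⟩
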